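/- **Setting.** Let $(\bm i,\bm j,\bm k)$ be a direct orthonormal body frame of a vehicle of mass $m>0$ and velocity $\bm v$, let $\bm g$ be the (vertical) gravity vector, $\bm v_w(t)$ a continuously differentiable wind velocity, $\bm v_a=\bm v-\bm v_w$ the air velocity, and $k_a=\rho\Sigma/2>0$. Let $\alpha\in[0,\pi]$ be the angle between $-\bm k$ and $\bm v_a$, and $\beta=\mathrm{atan2}(\bm v_a\cdot\bm j,\bm v_a\cdot\bm i)$. The vehicle is axisymmetric: its aerodynamic force is $$\bm F_a=k_a|\bm v_a|\,C_L(\alpha)\,\bm r(\beta)\times\bm v_a-k_a|\bm v_a|\,C_D(\alpha)\,\bm v_a,\qquad \bm r(\beta)=-\sin\beta\,\bm i+\cos\beta\,\bm j,$$ with $C_L(0)=C_L(\pi)=0$. Assume that $C_D(\alpha)+C_L(\alpha)\cot\alpha=C_{D_0}$ for all $\alpha\in(0,\pi)$, with $C_{D_0}$ constant, and put $\bm F_p(\bm v_a)=-k_aC_{D_0}|\bm v_a|\bm v_a$. Let $\bm v_r$ be a three times differentiable reference velocity, $\bm a_r=\dot{\bm v}_r$, $\tilde{\bm v}=\bm v-\bm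 v_r$, and assume that $\bm v_{r,a}=\bm v_r-\bm v_w$ is bounded on $[0,\infty)$. Let $\bm f(\tilde{\bm\rho},\tilde{\bm v})\in\mathbb R^p$ ($p\ge 0$) and $\bm\xi(\tilde{\bm\rho},\tilde{\bm v})\in\mathbb R^3$ be of class $C^1$ (in particular, they may be smooth), and put $$\bar{\bm F}_p=\bm F_p(\bm v_a)+m(\bm g-\bm a_r-\bm\xi),\qquad \bar{\bm F}_a=\bm F_a+m(\bm g-\bm a_r-\bm\xi).$$ The underactuated system, with inputs $T$ and $\bm\omega$, is $$\dot{\tilde{\bm\rho}}=\bm f(\tilde{\bm\rho},\tilde{\bm v}),\qquad m\dot{\bm v}=m\bm g+\bm F_a-T\bm k,\qquad \tfrac{d}{dt}(\bm i,\bm j,\bm k)=\bm\omega\times(\bm i,\bm j,\bm k).$$ Let $c_2>0$ and, where $\bar{\bm F}_p\neq 0$, let $\bm k_r=\bar{\bm F}_p/|\bar{\bm F}_p|$, $\gamma=\sqrt{c_2+|\bar{\bm F}_p|^2}$, $\bm\omega_r=\bm k_r\times\dot{\bm k}_r$ (the time derivatives being taken along the closed-loop trajectory) and $$T=\bar{\bm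 F}_a\cdot\bm k,\qquad \bm\omega=\Bigl(k_1+\frac{\dot\gamma}{\gamma}\Bigr)\bm k\times\bm k_r+\bm\omega_r+\lambda\,\bm k,$$ where $k_1$ and $\lambda$ are any continuous real functions of $(\tilde{\bm\rho},\bm v,\bm k,t)$ (for example of $(\bm k,t)$ only), defined for $|\bm k|=1$, $t\ge0$, $\bar{\bm F}_p\ne0$, with $\inf k_1>0$. **Proposition.** Assume that * **A1:** $\bm\xi$ makes $(\tilde{\bm\rho},\tilde{\bm v})=(\bm 0,\bm 0)$ a locally exponentially stable equilibrium of $\dot{\tilde{\bm\rho}}=\bm f(\tilde{\bm\rho},\tilde{\bm v})$, $\dot{\tilde{\bm v}}=\bm\xi(\tilde{\bm\rho},\tilde{\bm v})$; * **A2:** there is $\delta>0$ with $|\bm F_p(\bm v_{r,a}(t))+m(\bm g-\bm a_r(t))|\ge\delta$ for all $t\ge0$. Then $(\tilde{\bm\rho},\bm v,\bm k)=(\bm 0,\bm v_r,\bm k_r)$, where $\bm k_r(t)$ is evaluated at $(\tilde{\bm\rho},\bm v)=(\bm 0,\bm v_r(t))$, is locally exponentially stable for the closed-loop underactuated system. That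 is, there is a rate $\mu>0$ such that for each initial time $t_0\ge0$ there are $r,C>0$ with the following property: for each initial state at distance $e_0<r$ from $(\bm 0,\bm v_r(t_0),\bm k_r(t_0))$, a solution exists on $[t_0,\infty)$, and every solution on an interval $[t_0,b)$ that starts there stays at distance at most $Ce^{-\mu(t-t_0)}e_0$ from $(\bm 0,\bm v_r(t),\bm k_r(t))$. If moreover $\bm a_r$ is bounded on $[0,\infty)$, then $r$ and $C$ can be chosen independently of $t_0$ (uniform local exponential stability). -/

import Mathlib

open Set Real

noncomputable section

/-- Euclidean 3-space; coordinates are taken in the inertial North-East-Down frame. -/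
abbrev E3 : Type := EuclideanSpace ℝ (Fin 3)

/-- The space of the additional error variable `ρ̃`; `p = 0` is the case without such a variable. -/
abbrev Rho (p : ℕ) : Type := EuclideanSpace ℝ (Fin p)

/-- The cross product on Euclidean 3-space. -/
def cross (x y : E3) : E3 := WithLp.toLp 2 (crossProduct x.ofLp y.ofLp)

/-- The physical parameters of an axisymmetric thrust-propelled vehicle.  The Reynolds and Mach
numbers are constant, so by axisymmetry the drag and lift coefficients are functions of the angle
of attack only, and there is no lift when the air velocity is along the symmetry axis. -/
structure AxisymmetricVehicle where
  /-- mass -/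
  m : ℝ
  /-- gravitational acceleration -/
  grav : ℝ
  /-- air density -/
  density : ℝ
  /-- reference area -/
  area : ℝ
  /-- drag coefficient -/
  CD : ℝ → ℝ
  /-- lift coefficient -/
  CL : ℝ → ℝ
  m_pos : 0 < m
  density_pos : 0 < density
  area_pos : 0 < area
  CL_zero : CL 0 = 0
  CL_pi : CL π = 0

namespace AxisymmetricVehicle

variable (V : AxisymmetricVehicle)

/-- The coefficient `k_a = ρ Σ / 2`. -/
def ka : ℝ := V.density * V.area / 2

/-- The gravity vector, pointing to the third axis (down) of the inertial frame. -/
def gvec : E3 := V.grav • EuclideanSpace.single 2 1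

end AxisymmetricVehicle

/-- The angle of attack in `[0, π]`, between `-k` and the air velocity. -/
def attackAngle (k va : E3) : ℝ := arccos (-(inner ℝ va k) / ‖va‖)

/-- The angle `β = atan2 (va · j, va · i)` in `(-π, π]`. -/
def sideAngle (i j va : E3) : ℝ := Complex.arg ⟨inner ℝ va i, inner ℝ va j⟩

/-- The unit vector `r(β) = - sin β i + cos β j`. -/
def liftAxis (i j va : E3) : E3 :=
  -(sin (sideAngle i j va)) • i + cos (sideAngle i j va) • j

namespace AxisymmetricVehicle

variable (V : AxisymmetricVehicle)

/-- The lift force. -/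
def liftForce (i j k va : E3) : E3 :=
  (V.ka * ‖va‖ * V.CL (attackAngle k va)) • cross (liftAxis i j va) va

/-- The drag force. -/
def dragForce (k va : E3) : E3 :=
  -(V.ka * ‖va‖ * V.CD (attackAngle k va)) • va

/-- The aerodynamic force `F_a = F_L + F_D`. -/
def aeroForce (i j k va : E3) : E3 := V.liftForce i j k va + V.dragForce k va

/-- The aerodynamic relation `C_D(α) + C_L(α) cot α = C_{D0}`, wherever `cot α` is defined. -/
def SphericalEquivalence (CD0 : ℝ) : Prop :=
  ∀ α ∈ Ioo (0 : ℝ) π, V.CD α + V.CL α * Real.cot α = CD0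

/-- The equivalent, orientation independent drag force `F_p(v_a) = - k_a C_{D0} |v_a| v_a`. -/
def equivDrag (CD0 : ℝ) (va : E3) : E3 := -(V.ka * CD0 * ‖va‖) • va

end AxisymmetricVehicle

/-- The state `(ρ̃, v, (i, j, k))` of the underactuated system: the additional error variable, the
velocity, and the body frame, a direct orthonormal frame. -/
structure VehicleState (p : ℕ) where
  rho : Rho p
  v : E3
  i : E3
  j : E3
  k : E3
  orthonormal : Orthonormal ℝ ![i, j, k]
  direct : cross i j = k

/-- The data of the tracking problem and of the control law.  The gains `k₁` and `lam` may depend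
on `(ρ̃, v, k, t)`; in particular they may depend on `(k, t)` only. -/
structure TrackingData (p : ℕ) where
  /-- the vehicle -/
  veh : AxisymmetricVehicle
  /-- the constant `C_{D0}` -/
  CD0 : ℝ
  /-- the dynamics `f(ρ̃, ṽ)` of the variable `ρ̃` -/
  f : Rho p × E3 → Rho p
  /-- the controller `ξ(ρ̃, ṽ)` of the fully actuated system -/
  ξ : Rho p × E3 → E3
  /-- the reference velocity -/
  vr : ℝ → E3
  /-- the wind velocity -/
  vw : ℝ → E3
  /-- the gain `k₁` -/
  k₁ : Rho p × E3 × E3 × ℝ → ℝ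
  /-- the gain `λ` -/
  lam : Rho p × E3 × E3 × ℝ → ℝ
  /-- the constant in `γ` -/
  c₂ : ℝ

namespace TrackingData

variable {p : ℕ} (D : TrackingData p)

/-- The reference acceleration `a_r`, the derivative of `v_r`. -/
def ar (t : ℝ) : E3 := deriv D.vr t

/-- `F̄_p(v_a, a_r, ξ) = F_p(v_a) + m (g - a_r - ξ)`. -/
def Fpbar (va a ξ : E3) : E3 :=
  D.veh.equivDrag D.CD0 va + D.veh.m • (D.veh.gvec - a - ξ)

/-- The value of `F̄_p` at time `t` when the state is `(ρ̃, v)`. -/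
def FpbarAt (t : ℝ) (rho : Rho p) (v : E3) : E3 :=
  D.Fpbar (v - D.vw t) (D.ar t) (D.ξ (rho, v - D.vr t))

/-- The value of `F̄_p` along the reference velocity, with `ξ = 0`. -/
def FpbarRef (t : ℝ) : E3 := D.Fpbar (D.vr t - D.vw t) (D.ar t) 0

/-- The thrust direction along the reference velocity. -/
def kRef (t : ℝ) : E3 := ‖D.FpbarRef t‖⁻¹ • D.FpbarRef t

/-- The desired thrust direction `k_r = F̄_p / |F̄_p|` in the current state. -/
def kr (t : ℝ) (x : VehicleState p) : E3 :=
  ‖D.FpbarAt t x.rho x.v‖⁻¹ • D.FpbarAt t x.rho x.v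

/-- `γ = √(c₂ + |F̄_p|²)` in the current state. -/
def γ (t : ℝ) (x : VehicleState p) : ℝ := √(D.c₂ + ‖D.FpbarAt t x.rho x.v‖ ^ 2)

/-- The aerodynamic force in the current state. -/
def Fa (t : ℝ) (x : VehicleState p) : E3 := D.veh.aeroForce x.i x.j x.k (x.v - D.vw t)

/-- `F̄_a = F_a + m (g - a_r - ξ)` in the current state. -/
def Fabar (t : ℝ) (x : VehicleState p) : E3 :=
  D.Fa t x + D.veh.m • (D.veh.gvec - D.ar t - D.ξ (x.rho, x.v - D.vr t))

/-- The thrust intensity `T = F̄_a · k`. -/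
def thrust (t : ℝ) (x : VehicleState p) : ℝ := inner ℝ (D.Fabar t x) x.k

/-- The angular velocity
`ω = (k₁ + γ̇/γ) k × k_r + ω_r + λ k`, `ω_r = k_r × k̇_r`, at time `t` along a trajectory `x` on the
time interval `I`; the dots are time derivatives along this trajectory. -/
def omega (I : Set ℝ) (x : ℝ → VehicleState p) (t : ℝ) : E3 :=
  (D.k₁ ((x t).rho, (x t).v, (x t).k, t)
      + derivWithin (fun s => D.γ s (x s)) I t / D.γ t (x t)) • cross (x t).k (D.kr t (x t))
    + cross (D.kr t (x t)) (derivWithin (fun s => D.kr s (x s)) I t)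
    + D.lam ((x t).rho, (x t).v, (x t).k, t) • (x t).k

/-- `x` solves, on the time interval `I`, the underactuated system
`ρ̃' = f(ρ̃, v - v_r)`, `m v' = m g + F_a - T k`, `(i, j, k)' = ω × (i, j, k)`
in closed loop with the thrust `T` and the angular velocity `ω` above; along a solution `F̄_p` does
not vanish, so that the feedback law is defined. -/
structure IsClosedLoopSolution (I : Set ℝ) (x : ℝ → VehicleState p) : Prop where
  Fpbar_ne_zero : ∀ t ∈ I, D.FpbarAt t (x t).rho (x t).v ≠ 0
  rho_eq : ∀ t ∈ I, HasDerivWithinAt (fun s => (x s).rho)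
    (D.f ((x t).rho, (x t).v - D.vr t)) I t
  v_eq : ∀ t ∈ I, HasDerivWithinAt (fun s => (x s).v)
    (D.veh.m⁻¹ • (D.veh.m • D.veh.gvec + D.Fa t (x t) - D.thrust t (x t) • (x t).k)) I t
  i_eq : ∀ t ∈ I, HasDerivWithinAt (fun s => (x s).i) (cross (D.omega I x t) (x t).i) I t
  j_eq : ∀ t ∈ I, HasDerivWithinAt (fun s => (x s).j) (cross (D.omega I x t) (x t).j) I t
  k_eq : ∀ t ∈ I, HasDerivWithinAt (fun s => (x s).k) (cross (D.omega I x t) (x t).k) I t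

/-- `x` solves, on the time interval `I`, the fully actuated system
`ρ̃' = f(ρ̃, ṽ)`, `ṽ' = ξ(ρ̃, ṽ)`. -/
def IsFullyActuatedSolution (I : Set ℝ) (x : ℝ → Rho p × E3) : Prop :=
  ∀ t ∈ I, HasDerivWithinAt x (D.f (x t), D.ξ (x t)) I t

/-- The distance, at time `t`, of `(ρ̃, v, k)` to `(0, v_r(t), k_r(t))`. -/
def closedLoopError (t : ℝ) (x : VehicleState p) : ℝ :=
  ‖x.rho‖ + ‖x.v - D.vr t‖ + ‖x.k - D.kRef t‖

/-- The set of `(ρ̃, v, k, t)` where the feedback law is defined. -/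
def gainDomain : Set (Rho p × E3 × E3 × ℝ) :=
  {q | ‖q.2.2.1‖ = 1 ∧ 0 ≤ q.2.2.2 ∧ D.FpbarAt q.2.2.2 q.1 q.2.1 ≠ 0}

end TrackingData

/-- Every state whose error at time `t₀` is less than `r` is the initial state of a solution on
`[t₀, ∞)`, and every solution that starts in such a state, on whatever interval `[t₀, b)`, has an
error that is at most `C exp(-μ (t - t₀))` times the initial error. -/
def ExpEstimate {S : Type} (IsSol : Set ℝ → (ℝ → S) → Prop) (err : ℝ → S → ℝ)
    (t₀ r C μ : ℝ) : Prop :=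
  ∀ x₀ : S, err t₀ x₀ < r →
    (∃ x : ℝ → S, IsSol (Ici t₀) x ∧ x t₀ = x₀) ∧
    ∀ (b : ℝ) (x : ℝ → S), IsSol (Ico t₀ b) x → x t₀ = x₀ →
      ∀ t ∈ Ico t₀ b, err t (x t) ≤ C * Real.exp (-μ * (t - t₀)) * err t₀ x₀

/-- Local exponential stability of the zero error for each initial time. -/
def LocallyExpStable {S : Type} (IsSol : Set ℝ → (ℝ → S) → Prop) (err : ℝ → S → ℝ) : Prop :=
  ∃ μ > 0, ∀ t₀ : ℝ, 0 ≤ t₀ → ∃ r > 0, ∃ C > 0, ExpEstimate IsSol err t₀ r C μ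

/-- Local exponential stability of the zero error, uniformly in the initial time. -/
def UniformlyLocallyExpStable {S : Type} (IsSol : Set ℝ → (ℝ → S) → Prop)
    (err : ℝ → S → ℝ) : Prop :=
  ∃ μ > 0, ∃ r > 0, ∃ C > 0, ∀ t₀ : ℝ, 0 ≤ t₀ → ExpEstimate IsSol err t₀ r C μ

end

/-! Under the relation between `CD` and `CL`, the aerodynamic force is the equivalent drag plus a
force along `k` (`SphericalEquivalence.exists_aeroForce_eq`), and the thrust feedback cancels
everything along `k`. Hence `(ρ̃, ṽ)` obeys the fully actuated system perturbed by `m⁻¹` times the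
component of `F̄_p` orthogonal to `k` (`velocity_field_eq`).

If `θ` is the angle between `k` and `k_r`, the feedback `ω` gives `θ' = -(k₁ + γ'/γ) sin θ`, so `γ²
tan² (θ/2)` decays at the rate `2κ`, where `κ > 0` is a lower bound of `k₁` (`alignment_decay`). As
`γ ≥ |F̄_p|`, the force error `|F̄_p| sin θ` decays exponentially with no upper bound on `F̄_p`
along the trajectory; as `γ ≥ √c₂`, so does `k - k_r` (`alignment_estimate`).

A locally exponentially stable system with a locally Lipschitz field tolerates exponentially
decaying perturbations (`HasExpDecay.exists_of_perturbation`). The proof uses no Lyapunov function: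
Gronwall's inequality is applied on successive intervals of a fixed length over which the
unperturbed solution contracts. This controls `(ρ̃, ṽ)`. Near the reference `F̄_p` stays away from
zero and is Lipschitz in the error, which turns closeness to `k_r` into closeness to `kRef`
(`exists_closedLoop_estimate`). The constants depend on `t₀` only through the size of `F̄_p` on the
reference at time `t₀`, which is bounded when `a_r` is.

Existence is a separate matter, since the gains are only continuous. The closed-loop field is
extended continuously and cut off, Peano's theorem gives a global solution, and the a priori
estimate keeps it where the modifications have no effect (`exists_isClosedLoopSolution`). -/

/-! ### Continuation and Peano's existence theorem -/

/-- A strict bound that cannot be lost for the first time holds throughout. -/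
theorem lt_of_continuation {g : ℝ → ℝ} {a b R : ℝ} (hg : ContinuousOn g (Icc a b))
    (h : ∀ t ∈ Icc a b, (∀ s ∈ Ico a t, g s < R) → g t < R) : ∀ t ∈ Icc a b, g t < R := by
  intro t ht
  by_contra hcon
  push Not at hcon
  -- The times at which the bound fails form a compact set, whose least element contradicts `h`.
  have hcl : IsCompact (Icc a b ∩ g ⁻¹' Ici R) :=
    isCompact_Icc.of_isClosed_subset (hg.preimage_isClosed_of_isClosed isClosed_Icc isClosed_Ici)
      inter_subset_left
  obtain ⟨c, ⟨hc, hcR⟩, hmin⟩ := hcl.exists_isLeast ⟨t, ht, hcon⟩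
  refine absurd (h c hc fun s hs => ?_) (not_lt.2 hcR)
  by_contra hsR
  exact absurd (hmin ⟨⟨hs.1, hs.2.le.trans hc.2⟩, not_lt.1 hsR⟩) (not_le.2 hs.2)

/-- The nodes of the Euler scheme with step `h` for `y' = F t y`, `y t₀ = x₀`. -/
noncomputable def eulerNode {E : Type*} [NormedAddCommGroup E] [NormedSpace ℝ E] (F : ℝ → E → E)
    (t₀ h : ℝ) (x₀ : E) : ℕ → E
  | 0 => x₀
  | n + 1 => eulerNode F t₀ h x₀ n + h • F (t₀ + n * h) (eulerNode F t₀ h x₀ n)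

section Peano

variable {E : Type*} [NormedAddCommGroup E] [NormedSpace ℝ E]

/-- The increments of the scheme telescope. With `v = 0` this bounds the speed of the nodes; with
`v` the value of the field at a limit point it controls the difference quotient. -/
theorem norm_eulerNode_sub_sub_le {F : ℝ → E → E} {t₀ h : ℝ} {x₀ v : E} {ε : ℝ} (hh : 0 ≤ h)
    {a b : ℕ} (hab : a ≤ b)
    (hF : ∀ j, a ≤ j → j < b → ‖F (t₀ + j * h) (eulerNode F t₀ h x₀ j) - v‖ ≤ ε) :
    ‖eulerNode F t₀ h x₀ b - eulerNode F t₀ h x₀ a - ((b * h - a * h) : ℝ) • v‖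
      ≤ ε * (b * h - a * h) := by
  induction b, hab using Nat.le_induction with
  | base => simp
  | succ b hab ih =>
    have h1 := ih fun j hj hj' => hF j hj (by omega)
    have h2 := hF b hab (by omega)
    have h3 : eulerNode F t₀ h x₀ (b + 1) - eulerNode F t₀ h x₀ a
          - (((b + 1 : ℕ) * h - a * h) : ℝ) • v
        = (eulerNode F t₀ h x₀ b - eulerNode F t₀ h x₀ a - ((b * h - a * h) : ℝ) • v)
          + h • (F (t₀ + b * h) (eulerNode F t₀ h x₀ b) - v) := by
      rw [eulerNode]; push_cast; module
    rw [h3]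
    refine (norm_add_le _ _).trans ?_
    rw [norm_smul, Real.norm_of_nonneg hh]
    push_cast
    nlinarith [mul_le_mul_of_nonneg_left h2 hh]

theorem norm_eulerNode_sub_le {F : ℝ → E → E} {t₀ h N M : ℝ} {x₀ : E} (hh : 0 ≤ h)
    (hM : ∀ t ∈ Icc t₀ N, ∀ y, ‖F t y‖ ≤ M) {a b : ℕ} (ha : t₀ + a * h ≤ N)
    (hb : t₀ + b * h ≤ N) :
    ‖eulerNode F t₀ h x₀ b - eulerNode F t₀ h x₀ a‖ ≤ M * |b * h - a * h| := by
  wlog hab : a ≤ b generalizing a b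
  · rw [norm_sub_rev, abs_sub_comm]
    exact this hb ha (by omega)
  have hab' : (a : ℝ) * h ≤ b * h := by gcongr
  rw [abs_of_nonneg (by linarith)]
  have := norm_eulerNode_sub_sub_le (F := F) (t₀ := t₀) (x₀ := x₀) (v := 0) (ε := M) hh hab ?_
  · simpa using this
  · intro j _ hj
    have : (j : ℝ) * h ≤ b * h := by gcongr
    rw [sub_zero]
    exact hM _ ⟨by nlinarith [mul_nonneg (Nat.cast_nonneg (α := ℝ) j) hh], by linarith⟩ _

open Filter Topology in
/-- **Peano's existence theorem** on a half-line, for a continuous vector field that is bounded on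
bounded time intervals. -/
theorem exists_hasDerivWithinAt_Ici_of_continuous [ProperSpace E] {F : ℝ → E → E}
    (hF : Continuous fun q : ℝ × E => F q.1 q.2) {t₀ : ℝ}
    (hM : ∀ N, ∃ M, ∀ t ∈ Icc t₀ N, ∀ y, ‖F t y‖ ≤ M) (x₀ : E) :
    ∃ x : ℝ → E, x t₀ = x₀ ∧ ∀ t ∈ Ici t₀, HasDerivWithinAt x (F t (x t)) (Ici t₀) t := by
  set h : ℕ → ℝ := fun n => 1 / ((n : ℝ) + 1) with hh_def
  have hh : ∀ n, 0 < h n := fun n => by positivity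
  have hh0 : Tendsto h (hyperfilter ℕ) (𝓝 0) :=
    tendsto_one_div_add_atTop_nhds_zero_nat.mono_left Nat.hyperfilter_le_atTop
  set idx : ℕ → ℝ → ℕ := fun n t => ⌊(t - t₀) / h n⌋₊ with hidx
  have idx_le : ∀ n t, t₀ ≤ t → idx n t * h n ≤ t - t₀ := fun n t ht =>
    (le_div_iff₀ (hh n)).1 (Nat.floor_le (div_nonneg (by linarith) (hh n).le))
  have lt_idx : ∀ n t, t - t₀ < idx n t * h n + h n := fun n t => by
    have := (div_lt_iff₀ (hh n)).1 (Nat.lt_floor_add_one ((t - t₀) / h n))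
    simpa [add_mul] using this
  set X : ℕ → ℝ → E := fun n t => eulerNode F t₀ (h n) x₀ (idx n t) with hX
  -- Along a nonprincipal ultrafilter every bounded sequence of a proper space converges, so the
  -- step functions `X n` converge at all times at once, without an Arzelà–Ascoli extraction.
  have hlim : ∀ t, ∃ y, t₀ ≤ t → Tendsto (fun n => X n t) (hyperfilter ℕ) (𝓝 y) := by
    intro t
    by_cases ht : t₀ ≤ t
    · obtain ⟨M, hM⟩ := hM t
      have hM0 : 0 ≤ M := (norm_nonneg _).trans (hM t ⟨ht, le_rfl⟩ x₀)
      obtain ⟨y, -, hy⟩ := (isCompact_closedBall x₀ (M * (t - t₀))).ultrafilter_le_nhds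
        ((hyperfilter ℕ).map fun n => X n t) (by
          rw [le_principal_iff]
          refine Filter.mem_map.2 (Filter.univ_mem' fun n => ?_)
          have h1 := idx_le n t ht
          have := norm_eulerNode_sub_le (x₀ := x₀) (hh n).le hM (a := 0) (b := idx n t)
            (by simpa using ht) (by linarith)
          rw [mem_preimage, mem_closedBall_iff_norm]
          refine this.trans ?_
          rw [Nat.cast_zero, zero_mul, sub_zero,
            abs_of_nonneg (mul_nonneg (Nat.cast_nonneg _) (hh n).le)]
          gcongr)
      exact ⟨y, fun _ => hy⟩
    · exact ⟨0, fun h => absurd h ht⟩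
  choose x hx using hlim
  refine ⟨x, ?_, fun t ht => ?_⟩
  · refine tendsto_nhds_unique (hx t₀ le_rfl) ?_
    simp [hX, hidx, eulerNode]
  have ht' : t₀ ≤ t := ht
  obtain ⟨M, hM⟩ := hM (t + 1)
  have hM0 : 0 ≤ M := (norm_nonneg _).trans (hM t ⟨ht, by linarith⟩ x₀)
  rw [hasDerivWithinAt_iff_isLittleO, Asymptotics.isLittleO_iff]
  intro ε hε
  obtain ⟨δ, hδ, hδF⟩ := Metric.continuousAt_iff.1 (hF.continuousAt (x := (t, x t))) ε hε
  -- For a mesh below `η`, the nodes that matter on `[t - η, t + η]` have times within `2 * η` of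
  -- `t` and positions within `M * (3 * η)` of `X n t`. The bound `η ≤ 1` keeps their times where
  -- `M` is valid.
  obtain ⟨η, hη, hη1, hηδ, hηM⟩ : ∃ η > 0, η ≤ 1 ∧ 2 * η < δ ∧ M * (3 * η) < δ / 2 := by
    refine ⟨min 1 (min (δ / 4) (δ / (8 * (M + 1)))), by positivity, min_le_left _ _, ?_, ?_⟩
    · have := (min_le_right 1 (min (δ / 4) (δ / (8 * (M + 1))))).trans (min_le_left _ _)
      linarith
    · have h1 := (min_le_right 1 (min (δ / 4) (δ / (8 * (M + 1))))).trans (min_le_right _ _)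
      have h2 := (le_div_iff₀ (by positivity)).1 h1
      have h3 : 0 < min 1 (min (δ / 4) (δ / (8 * (M + 1)))) := by positivity
      nlinarith
  have key : ∀ s₁ s₂, t₀ ≤ s₁ → s₁ ≤ s₂ → t - η ≤ s₁ → s₁ ≤ t → t ≤ s₂ → s₂ ≤ t + η →
      ‖x s₂ - x s₁ - (s₂ - s₁) • F t (x t)‖ ≤ ε * (s₂ - s₁) := by
    intro s₁ s₂ h01 h12 hs₁ hs₁t hts₂ hs₂
    have hidx0 : ∀ s, t₀ ≤ s → Tendsto (fun n => idx n s * h n) (hyperfilter ℕ) (𝓝 (s - t₀)) := by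
      intro s hs
      refine tendsto_of_tendsto_of_tendsto_of_le_of_le (g := fun n => s - t₀ - h n)
        (h := fun _ => s - t₀) ?_ tendsto_const_nhds (fun n => ?_) (fun n => idx_le n s hs)
      · simpa using tendsto_const_nhds.sub hh0
      · have := lt_idx n s
        show s - t₀ - h n ≤ idx n s * h n
        linarith
    have hd : Tendsto (fun n => (idx n s₂ * h n - idx n s₁ * h n : ℝ)) (hyperfilter ℕ)
        (𝓝 (s₂ - s₁)) := by
      have := (hidx0 s₂ (h01.trans h12)).sub (hidx0 s₁ h01)
      rwa [sub_sub_sub_cancel_right] at this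
    refine le_of_tendsto_of_tendsto
      (((hx s₂ (h01.trans h12)).sub (hx s₁ h01)).sub (hd.smul_const (F t (x t)))).norm
      (hd.const_mul ε) ?_
    have e1 : ∀ᶠ n in (hyperfilter ℕ : Filter ℕ), h n < η := hh0.eventually (gt_mem_nhds hη)
    have e2 : ∀ᶠ n in (hyperfilter ℕ : Filter ℕ), dist (X n t) (x t) < δ / 2 :=
      (hx t ht).eventually (Metric.ball_mem_nhds _ (by positivity))
    filter_upwards [e1, e2] with n hn1 hn2
    have hle : idx n s₁ ≤ idx n s₂ :=
      Nat.floor_mono (div_le_div_of_nonneg_right (by linarith) (hh n).le)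
    refine norm_eulerNode_sub_sub_le (hh n).le hle fun j hj1 hj2 => ?_
    have hj1' : (idx n s₁ : ℝ) * h n ≤ j * h n :=
      mul_le_mul_of_nonneg_right (by exact_mod_cast hj1) (hh n).le
    have hj2' : (j : ℝ) * h n ≤ idx n s₂ * h n :=
      mul_le_mul_of_nonneg_right (by exact_mod_cast hj2.le) (hh n).le
    have := lt_idx n s₁
    have := idx_le n s₂ (h01.trans h12)
    have i1 := lt_idx n t
    have i2 := idx_le n t ht
    have hhn := hh n
    have hdist : ‖eulerNode F t₀ (h n) x₀ j - X n t‖ ≤ M * (3 * η) := by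
      refine (norm_eulerNode_sub_le (hh n).le hM (by linarith) (by linarith)).trans ?_
      gcongr
      rw [abs_le]
      constructor <;> linarith
    rw [← dist_eq_norm]
    refine (hδF (x := (t₀ + j * h n, eulerNode F t₀ (h n) x₀ j)) ?_).le
    rw [Prod.dist_eq, max_lt_iff]
    constructor
    · rw [Real.dist_eq, abs_lt]
      constructor <;> simp only <;> linarith
    · refine (dist_triangle _ (X n t) _).trans_lt ?_
      rw [dist_eq_norm]
      linarith
  have hnear : ∀ᶠ s in 𝓝[Ici t₀] t, s ∈ Icc (t - η) (t + η) :=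
    mem_nhdsWithin_of_mem_nhds (Icc_mem_nhds (by linarith) (by linarith))
  filter_upwards [hnear, self_mem_nhdsWithin] with s hs hs0
  have hs0 : t₀ ≤ s := hs0
  rw [Real.norm_eq_abs]
  rcases le_total s t with hst | hst
  · have := key s t hs0 hst hs.1 hst le_rfl (by linarith)
    rw [abs_of_nonpos (by linarith), ← norm_neg (x s - x t - _)]
    rwa [show -(x s - x t - (s - t) • F t (x t)) = x t - x s - (t - s) • F t (x t) by module,
      show -(s - t) = t - s by ring]
  · have := key t s ht' hst (by linarith) le_rfl hst hs.2
    rwa [abs_of_nonneg (by linarith)]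

end Peano

/-! ### Radial cut-off -/

section Clip

variable {E : Type*} [NormedAddCommGroup E] [NormedSpace ℝ E]

/-- The radial retraction to the closed ball of radius `R`. -/
noncomputable def clip (R : ℝ) (x : E) : E := (R / max R ‖x‖) • x

theorem continuous_clip {R : ℝ} (hR : 0 < R) : Continuous (clip R : E → E) :=
  (continuous_const.div (continuous_const.max continuous_norm) fun _ =>
    (lt_max_of_lt_left hR).ne').smul continuous_id

theorem norm_clip_le {R : ℝ} (hR : 0 < R) (x : E) : ‖clip R x‖ ≤ R := by
  have h : 0 < max R ‖x‖ := lt_max_of_lt_left hR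
  rw [clip, norm_smul, Real.norm_of_nonneg (by positivity), div_mul_eq_mul_div, div_le_iff₀ h]
  gcongr
  exact le_max_right _ _

theorem clip_of_norm_le {R : ℝ} (hR : 0 < R) {x : E} (hx : ‖x‖ ≤ R) : clip R x = x := by
  rw [clip, max_eq_left hx, div_self hR.ne', one_smul]

end Clip

/-! ### Robustness of exponential decay -/

theorem gronwallBound_zero_eq_mul (K ε x : ℝ) :
    gronwallBound 0 K ε x = ε * gronwallBound 0 K 1 x := by
  unfold gronwallBound
  split_ifs <;> ring

section Perturbation

variable {E : Type*} [NormedAddCommGroup E] [NormedSpace ℝ E]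

theorem HasDerivWithinAt.Ici_of_Ico {f : ℝ → E} {f' : E} {a b t : ℝ}
    (h : HasDerivWithinAt f f' (Ico a b) t) (ht : t ∈ Ico a b) :
    HasDerivWithinAt f f' (Ici t) t :=
  (h.mono (t := Ico a b) (s := Ico t b) (Ico_subset_Ico_left ht.1)).mono_of_mem_nhdsWithin
    (Ico_mem_nhdsGE ht.2)

/-- Local exponential estimate for the solutions of `z' = Φ z`, one of which is assumed to exist
for each small initial value. -/
def HasExpDecay (Φ : E → E) (r C μ : ℝ) : Prop :=
  ∀ τ : ℝ, 0 ≤ τ → ∀ x₀ : E, ‖x₀‖ < r → ∃ z : ℝ → E, z τ = x₀ ∧ ∀ t ∈ Ici τ,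
    HasDerivWithinAt z (Φ (z t)) (Ici τ) t ∧ ‖z t‖ ≤ C * Real.exp (-μ * (t - τ)) * ‖x₀‖

/-- On a time interval of length at most `T`, a small perturbation of an exponentially decaying
system moves the solution by at most a multiple of the size of the perturbation. -/
theorem HasExpDecay.norm_le_of_perturbation {Φ : E → E} {r C μ : ℝ} (hΦ : HasExpDecay Φ r C μ)
    (hμ : 0 < μ) (hC : 0 ≤ C) {K : NNReal} {R : ℝ} (hK : LipschitzOnWith K Φ (Metric.ball 0 R))
    {T : ℝ} {τ b ε : ℝ} (hτ : 0 ≤ τ) {y d : ℝ → E}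
    (hy : ∀ t ∈ Ico τ b, HasDerivWithinAt y (Φ (y t) + d t) (Ico τ b) t)
    (hd : ∀ t ∈ Ico τ b, ‖d t‖ ≤ ε) (hr : ‖y τ‖ < r)
    (hR : C * ‖y τ‖ + ε * gronwallBound 0 K 1 T < R) :
    ∀ t ∈ Ico τ b, t ≤ τ + T →
      ‖y t‖ ≤ C * Real.exp (-μ * (t - τ)) * ‖y τ‖ + ε * gronwallBound 0 K 1 T := by
  intro t₁ ht₁ ht₁T
  obtain ⟨z, hz0, hz⟩ := hΦ τ hτ (y τ) hr
  have hε : 0 ≤ ε := (norm_nonneg _).trans (hd t₁ ht₁)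
  have hmono : Monotone (gronwallBound 0 K 1) := gronwallBound_mono le_rfl zero_le_one K.2
  have hG : ∀ t, τ ≤ t → t ≤ t₁ → gronwallBound 0 K ε (t - τ) ≤ ε * gronwallBound 0 K 1 T := by
    intro t _ h2
    rw [gronwallBound_zero_eq_mul]
    exact mul_le_mul_of_nonneg_left (hmono (by linarith)) hε
  have hG0 : 0 ≤ ε * gronwallBound 0 K 1 T := by
    have := hG τ le_rfl ht₁.1
    rwa [sub_self, gronwallBound_x0] at this
  have hexp : ∀ t, τ ≤ t → C * Real.exp (-μ * (t - τ)) * ‖y τ‖ ≤ C * ‖y τ‖ := by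
    intro t ht
    have : Real.exp (-μ * (t - τ)) ≤ 1 := Real.exp_le_one_iff.2 (by nlinarith)
    have := mul_le_mul_of_nonneg_left this hC
    rw [mul_one] at this
    exact mul_le_mul_of_nonneg_right this (norm_nonneg _)
  have hycont : ContinuousOn y (Icc τ t₁) := fun t ht =>
    ((hy t ⟨ht.1, ht.2.trans_lt ht₁.2⟩).continuousWithinAt).mono
      fun s hs => ⟨hs.1, hs.2.trans_lt ht₁.2⟩
  -- While `y` stays in the ball, Gronwall's inequality compares it with the unperturbed solution
  -- `z` from the same point. By `hR` the resulting bound is below `R`, so `y` cannot leave the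
  -- ball.
  have key : ∀ t ∈ Icc τ t₁, (∀ s ∈ Ico τ t, ‖y s‖ < R) →
      ‖y t‖ ≤ C * Real.exp (-μ * (t - τ)) * ‖y τ‖ + ε * gronwallBound 0 K 1 T := by
    intro t ht hs
    have hsub : Icc τ t ⊆ Icc τ t₁ := Icc_subset_Icc_right ht.2
    have hb : ∀ s ∈ Ico τ t, s ∈ Ico τ b := fun s hs =>
      ⟨hs.1, (hs.2.trans_le ht.2).trans ht₁.2⟩
    have := dist_le_of_approx_trajectories_ODE_of_mem (v := fun _ => Φ)
      (s := fun _ => Metric.ball 0 R) (K := K) (a := τ) (b := t) (f := y) (g := z)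
      (f' := fun s => Φ (y s) + d s) (g' := fun s => Φ (z s)) (εf := ε) (εg := 0) (δ := 0)
      (fun _ _ => hK) (hycont.mono hsub) (fun s hs => (hy s (hb s hs)).Ici_of_Ico (hb s hs))
      (fun s hs => by simpa [dist_eq_norm] using hd s (hb s hs))
      (fun s hs' => by simpa using hs s hs')
      (fun s hs => ((hz s hs.1).1.continuousWithinAt).mono fun u hu => hu.1)
      (fun s hs => (hz s hs.1).1.mono (Ici_subset_Ici.2 hs.1))
      (fun s hs => by simp)
      (fun s hs => by
        rw [mem_ball_zero_iff]
        have h1 := (hz s hs.1).2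
        have h2 := hexp s hs.1
        linarith)
      (by simp [hz0]) t ⟨ht.1, le_rfl⟩
    rw [add_zero, dist_eq_norm] at this
    have h1 := (hz t ht.1).2
    have h2 := hG t ht.1 ht.2
    have h3 : ‖y t‖ ≤ ‖y t - z t‖ + ‖z t‖ := by
      simpa using norm_add_le (y t - z t) (z t)
    linarith
  have hlt := lt_of_continuation hycont.norm fun t ht hs => by
    have h1 := key t ht hs
    have h2 := hexp t ht.1
    linarith
  exact key t₁ ⟨ht₁.1, le_rfl⟩ fun s hs => hlt s ⟨hs.1, hs.2.le⟩

/-- Exponential decay is robust to exponentially decaying perturbations. -/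
theorem HasExpDecay.exists_of_perturbation {Φ : E → E} {r C μ : ℝ} (hΦ : HasExpDecay Φ r C μ)
    (hr : 0 < r) (hμ : 0 < μ) (hC : 0 ≤ C) {K : NNReal} {R : ℝ} (hR : 0 < R)
    (hK : LipschitzOnWith K Φ (Metric.ball 0 R)) {κ : ℝ} (hκ : 0 < κ) :
    ∃ μ' > 0, μ' ≤ κ ∧ ∃ r' > 0, ∃ C' > 0, ∀ t₀ : ℝ, 0 ≤ t₀ → ∀ (b D : ℝ) (y d : ℝ → E),
      (∀ t ∈ Ico t₀ b, HasDerivWithinAt y (Φ (y t) + d t) (Ico t₀ b) t) →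
      (∀ t ∈ Ico t₀ b, ‖d t‖ ≤ D * Real.exp (-κ * (t - t₀))) →
      ‖y t₀‖ + D < r' →
      ∀ t ∈ Ico t₀ b, ‖y t‖ ≤ C' * Real.exp (-μ' * (t - t₀)) * (‖y t₀‖ + D) := by
  obtain ⟨T, hT, hCT⟩ : ∃ T > 0, C * Real.exp (-μ * T) ≤ 1 / 4 := by
    refine ⟨(4 * C + 1) / μ, by positivity, ?_⟩
    rw [neg_mul, mul_div_cancel₀ _ hμ.ne', Real.exp_neg, ← div_eq_mul_inv,
      div_le_iff₀ (Real.exp_pos _)]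
    have := Real.add_one_le_exp (4 * C + 1)
    linarith
  set G := gronwallBound 0 K 1 T with hG
  have hG0 : 0 ≤ G := by
    have := gronwallBound_mono (δ := 0) (ε := 1) le_rfl zero_le_one K.2 hT.le
    rwa [gronwallBound_x0] at this
  -- Over a period `T` the unperturbed part of the node bound shrinks to a quarter, and `G ≤ A / 4`
  -- makes the perturbation cost at most another quarter. The sum is half the old bound, while `exp
  -- (-μ' * t)` loses at most a factor 2 per period because `μ' ≤ log 2 / T`.
  set A := 4 * G + 1 with hA
  set μ' := min κ (Real.log 2 / T) with hμ'
  have hμ'0 : 0 < μ' := lt_min hκ (div_pos (Real.log_pos one_lt_two) hT)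
  have hμ'κ : μ' ≤ κ := min_le_left _ _
  have hexpT : Real.exp (μ' * T) ≤ 2 := by
    rw [← Real.le_log_iff_exp_le two_pos, ← le_div_iff₀ hT]
    exact min_le_right _ _
  have hA0 : 0 < A := by positivity
  clear_value A μ'
  have hB0 : 0 < C * A + G + A := by positivity
  -- This radius keeps the node bound `A * s` below `r` and the bound `C * A * s + s * G` within a
  -- period below `R`.
  refine ⟨μ', hμ'0, hμ'κ, min r R / (C * A + G + A), by positivity, 2 * (C * A + G + 1),
    by positivity, ?_⟩
  intro t₀ ht₀ b D y d hy hd hsmall t ht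
  set s := ‖y t₀‖ + D with hs
  have hD : 0 ≤ D := by
    have := (norm_nonneg _).trans (hd t₀ ⟨le_rfl, ht.1.trans_lt ht.2⟩)
    simpa using this
  have hs0 : 0 ≤ s := by positivity
  have hDs : D ≤ s := by have := norm_nonneg (y t₀); linarith
  have hsB : s * (C * A + G + A) < min r R := (lt_div_iff₀ hB0).1 hsmall
  -- the estimate on one step
  have step : ∀ n : ℕ, t₀ + n * T < b →
      ‖y (t₀ + n * T)‖ ≤ A * s * Real.exp (-μ' * (n * T)) →
      ∀ t ∈ Ico (t₀ + n * T) b, t ≤ t₀ + n * T + T →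
        ‖y t‖ ≤ C * Real.exp (-μ * (t - (t₀ + n * T))) * ‖y (t₀ + n * T)‖
          + s * Real.exp (-μ' * (n * T)) * G := by
    intro n hn hyn
    have hnT : 0 ≤ n * T := by positivity
    have hexp1 : Real.exp (-μ' * (n * T)) ≤ 1 := Real.exp_le_one_iff.2 (by nlinarith)
    have hyn' : ‖y (t₀ + n * T)‖ ≤ A * s :=
      hyn.trans (mul_le_of_le_one_right (by positivity) hexp1)
    have hsub : Ico (t₀ + n * T) b ⊆ Ico t₀ b := Ico_subset_Ico_left (by linarith)
    refine hΦ.norm_le_of_perturbation hμ hC hK (by positivity)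
      (fun t ht => (hy t (hsub ht)).mono hsub) (fun t ht => (hd t (hsub ht)).trans ?_) ?_ ?_
    · have : Real.exp (-κ * (t - t₀)) ≤ Real.exp (-μ' * (n * T)) :=
        Real.exp_le_exp.2 (by nlinarith [ht.1])
      gcongr
    · have : A * s ≤ s * (C * A + G + A) := by nlinarith [mul_nonneg hC hA0.le]
      have := hsB.trans_le (min_le_left _ _)
      linarith
    · have h1 : s * Real.exp (-μ' * (n * T)) * G ≤ s * G :=
        mul_le_mul_of_nonneg_right (mul_le_of_le_one_right hs0 hexp1) hG0
      have h2 : C * ‖y (t₀ + n * T)‖ ≤ C * (A * s) := mul_le_mul_of_nonneg_left hyn' hC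
      have := hsB.trans_le (min_le_right _ _)
      nlinarith [mul_nonneg hs0 hA0.le]
  have nodes : ∀ n : ℕ, t₀ + n * T < b →
      ‖y (t₀ + n * T)‖ ≤ A * s * Real.exp (-μ' * (n * T)) := by
    intro n
    induction n with
    | zero =>
      intro _
      simp only [Nat.cast_zero, zero_mul, add_zero, mul_zero, Real.exp_zero, mul_one]
      nlinarith
    | succ n ih =>
      intro hn
      push_cast at hn ⊢
      have hn' : t₀ + n * T < b := by nlinarith
      have h1 := step n hn' (ih hn') (t₀ + (n + 1) * T) ⟨by nlinarith, hn⟩ (by linarith)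
      rw [show t₀ + (n + 1) * T - (t₀ + n * T) = T by ring] at h1
      have h2 : C * Real.exp (-μ * T) * ‖y (t₀ + n * T)‖
          ≤ 1 / 4 * (A * s * Real.exp (-μ' * (n * T))) :=
        mul_le_mul hCT (ih hn') (norm_nonneg _) (by norm_num)
      have h3 : Real.exp (-μ' * (n * T)) ≤ 2 * Real.exp (-μ' * ((n + 1) * T)) := by
        rw [show -μ' * (n * T) = μ' * T + -μ' * ((n + 1) * T) by ring, Real.exp_add]
        gcongr
      have h4 : s * Real.exp (-μ' * (n * T)) * G
          ≤ 1 / 4 * (A * s * Real.exp (-μ' * (n * T))) := by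
        have : 0 ≤ s * Real.exp (-μ' * (n * T)) := by positivity
        nlinarith
      have h5 := mul_le_mul_of_nonneg_left h3 (mul_nonneg hA0.le hs0)
      linarith
  set n := ⌊(t - t₀) / T⌋₊ with hn
  have hn1 : n * T ≤ t - t₀ :=
    (le_div_iff₀ hT).1 (Nat.floor_le (div_nonneg (by linarith [ht.1]) hT.le))
  have hn2 : t - t₀ < (n + 1) * T := (div_lt_iff₀ hT).1 (Nat.lt_floor_add_one _)
  have hnb : t₀ + n * T < b := by linarith [ht.2]
  have h1 := step n hnb (nodes n hnb) t ⟨by linarith, ht.2⟩ (by linarith)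
  have h2 : Real.exp (-μ * (t - (t₀ + n * T))) ≤ 1 :=
    Real.exp_le_one_iff.2 (by linarith [mul_le_mul_of_nonneg_left hn1 hμ.le])
  have h3 : C * Real.exp (-μ * (t - (t₀ + n * T))) * ‖y (t₀ + n * T)‖
      ≤ C * (A * s * Real.exp (-μ' * (n * T))) :=
    mul_le_mul (mul_le_of_le_one_right hC h2) (nodes n hnb) (norm_nonneg _) hC
  have h4 : Real.exp (-μ' * (n * T)) ≤ 2 * Real.exp (-μ' * (t - t₀)) := by
    calc Real.exp (-μ' * (n * T)) ≤ Real.exp (μ' * T + -μ' * (t - t₀)) :=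
          Real.exp_le_exp.2 (by linarith [mul_le_mul_of_nonneg_left hn2.le hμ'0.le])
      _ = Real.exp (μ' * T) * Real.exp (-μ' * (t - t₀)) := Real.exp_add _ _
      _ ≤ _ := by gcongr
  have h5 : 0 ≤ (C * A + G) * s := by positivity
  have h6 := mul_le_mul_of_nonneg_left h4 h5
  have h7 : 0 ≤ s * Real.exp (-μ' * (t - t₀)) := by positivity
  linarith

end Perturbation

/-! ### Cross product and body frame -/

section CrossProduct

theorem inner_eq_coord (x y : E3) : inner ℝ x y = x 0 * y 0 + x 1 * y 1 + x 2 * y 2 := by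
  simp [PiLp.inner_apply, Fin.sum_univ_three, mul_comm]

theorem cross_eq_coord (x y : E3) : cross x y = !₂[x 1 * y 2 - x 2 * y 1,
    x 2 * y 0 - x 0 * y 2, x 0 * y 1 - x 1 * y 0] := by
  simp [cross, cross_apply]

theorem cross_add_left (x y z : E3) : cross (x + y) z = cross x z + cross y z := by
  simp [cross]

theorem cross_add_right (x y z : E3) : cross x (y + z) = cross x y + cross x z := by
  simp [cross]

theorem cross_smul_left (c : ℝ) (x y : E3) : cross (c • x) y = c • cross x y := by
  simp [cross]

theorem cross_smul_right (c : ℝ) (x y : E3) : cross x (c • y) = c • cross x y := by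
  simp [cross]

theorem cross_self_eq_zero (x : E3) : cross x x = 0 := by
  simp [cross]

theorem cross_swap (x y : E3) : cross x y = -cross y x := by
  rw [cross, cross, ← WithLp.toLp_neg, cross_anticomm]

theorem inner_cross_self_right (x y : E3) : inner ℝ (cross x y) y = 0 := by
  rw [inner_eq_coord, cross_eq_coord]; simp; ring

theorem inner_cross_swap (x y z : E3) : inner ℝ (cross x y) z = -inner ℝ (cross x z) y := by
  simp only [inner_eq_coord, cross_eq_coord]; simp; ring

theorem cross_cross_left (x y z : E3) :
    cross (cross x y) z = inner ℝ x z • y - inner ℝ y z • x := by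
  ext n; fin_cases n <;> simp [inner_eq_coord, cross_eq_coord] <;> ring

theorem cross_cross_right (x y z : E3) :
    cross x (cross y z) = inner ℝ x z • y - inner ℝ x y • z := by
  ext n; fin_cases n <;> simp [inner_eq_coord, cross_eq_coord] <;> ring

theorem continuous_cross : Continuous fun q : E3 × E3 => cross q.1 q.2 := by
  simp only [cross_eq_coord]
  refine (PiLp.continuous_toLp 2 _).comp (continuous_pi fun n => ?_)
  fin_cases n <;> simp <;> fun_prop

theorem Continuous.cross {X : Type*} [TopologicalSpace X] {f g : X → E3} (hf : Continuous f)
    (hg : Continuous g) : Continuous fun x => _root_.cross (f x) (g x) :=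
  continuous_cross.comp (hf.prodMk hg)

end CrossProduct

namespace VehicleState

variable {p : ℕ} (x : VehicleState p)

theorem norm_i : ‖x.i‖ = 1 := x.orthonormal.1 0
theorem norm_j : ‖x.j‖ = 1 := x.orthonormal.1 1
theorem norm_k : ‖x.k‖ = 1 := x.orthonormal.1 2
theorem inner_i_j : inner ℝ x.i x.j = 0 := x.orthonormal.2 (show (0 : Fin 3) ≠ 1 by decide)

theorem cross_j_k : cross x.j x.k = x.i := by
  rw [← x.direct, cross_cross_right, real_inner_self_eq_norm_sq, x.norm_j,
    real_inner_comm, x.inner_i_j]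
  simp

theorem cross_i_k : cross x.i x.k = -x.j := by
  rw [← x.direct, cross_cross_right, real_inner_self_eq_norm_sq, x.norm_i, x.inner_i_j]
  simp

theorem eq_sum_inner_smul (u : E3) :
    u = inner ℝ u x.i • x.i + inner ℝ u x.j • x.j + inner ℝ u x.k • x.k := by
  have hcard : Fintype.card (Fin 3) = Module.finrank ℝ E3 := by simp
  let b := (basisOfOrthonormalOfCardEqFinrank x.orthonormal hcard).toOrthonormalBasis
    (by rw [coe_basisOfOrthonormalOfCardEqFinrank]; exact x.orthonormal)
  have h := b.sum_repr' u
  rw [Fin.sum_univ_three] at h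
  have hb : ∀ n, b n = ![x.i, x.j, x.k] n := fun n => by simp [b]
  simp only [hb] at h
  rw [← real_inner_comm u x.i, ← real_inner_comm u x.j, ← real_inner_comm u x.k]
  exact h.symm

end VehicleState

/-! ### Reduction of the aerodynamic force to the equivalent drag -/

namespace AxisymmetricVehicle

variable {V : AxisymmetricVehicle} {p : ℕ}

/-- Under the spherical equivalence relation the aerodynamic force differs from the equivalent
drag by a force along the thrust axis. -/
theorem SphericalEquivalence.exists_aeroForce_eq {CD0 : ℝ} (h : V.SphericalEquivalence CD0)
    (x : VehicleState p) (va : E3) :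
    ∃ s : ℝ, V.aeroForce x.i x.j x.k va = V.equivDrag CD0 va + s • x.k := by
  set a := inner ℝ va x.i with ha
  set b := inner ℝ va x.j with hb
  set c := inner ℝ va x.k with hc
  set β := sideAngle x.i x.j va with hβ
  set α := attackAngle x.k va with hα
  set ρ := ‖(⟨a, b⟩ : ℂ)‖ with hρ
  have hva : va = a • x.i + b • x.j + c • x.k := x.eq_sum_inner_smul va
  have hacos : ρ * Real.cos β = a := Complex.norm_mul_cos_arg ⟨a, b⟩
  have hbsin : ρ * Real.sin β = b := Complex.norm_mul_sin_arg ⟨a, b⟩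
  have hnorm : ‖va‖ ^ 2 = ρ ^ 2 + c ^ 2 := by
    have h1 : ‖va‖ ^ 2 = a * a + b * b + c * c := by
      rw [← real_inner_self_eq_norm_sq]
      nth_rewrite 2 [hva]
      rw [inner_add_right, inner_add_right, inner_smul_right, inner_smul_right, inner_smul_right]
    have h2 : ρ ^ 2 = a * a + b * b := by rw [hρ, Complex.sq_norm, Complex.normSq_apply]
    rw [h1, h2]; ring
  -- Here `ρ = ‖va‖ sin α` is the air speed across the symmetry axis and `c = -‖va‖ cos α`.
  have hcross : cross (liftAxis x.i x.j va) va
      = (c * Real.cos β) • x.i + (c * Real.sin β) • x.j - ρ • x.k := by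
    have hji : cross x.j x.i = -x.k := by rw [cross_swap, x.direct]
    have hρ' : Real.sin β * b + Real.cos β * a = ρ := by
      rw [← hacos, ← hbsin]
      linear_combination ρ * Real.sin_sq_add_cos_sq β
    rw [liftAxis, ← hβ]
    nth_rewrite 1 [hva]
    simp only [cross_add_left, cross_add_right, cross_smul_left, cross_smul_right,
      cross_self_eq_zero, x.direct, hji, x.cross_i_k, x.cross_j_k]
    rw [← hρ']
    module
  have hcα : ‖va‖ ≠ 0 → ‖va‖ * Real.cos α = -c := by
    intro h0
    have habs := abs_real_inner_le_norm va x.k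
    rw [x.norm_k, mul_one, abs_le] at habs
    have hpos : 0 < ‖va‖ := lt_of_le_of_ne (norm_nonneg _) h0.symm
    rw [hα, attackAngle, Real.cos_arccos, mul_div_cancel₀ _ h0]
    · rw [le_div_iff₀ hpos]; linarith [habs.2]
    · rw [div_le_iff₀ hpos]; linarith [habs.1]
  have hsα0 : 0 ≤ Real.sin α := by
    rw [hα, attackAngle, Real.sin_arccos]; exact Real.sqrt_nonneg _
  have hsα : ‖va‖ ≠ 0 → ‖va‖ * Real.sin α = ρ := by
    intro h0
    have h1 := hcα h0
    have h2 : (‖va‖ * Real.sin α) ^ 2 = ρ ^ 2 := by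
      have h3 : c ^ 2 = ‖va‖ ^ 2 * Real.cos α ^ 2 := by rw [← neg_sq c, ← h1]; ring
      linear_combination ‖va‖ ^ 2 * Real.sin_sq_add_cos_sq α + hnorm + h3
    exact (pow_left_inj₀ (by positivity) (norm_nonneg _) two_ne_zero).1 h2
  rw [aeroForce, liftForce, dragForce, equivDrag, hcross, ← hα]
  by_cases h0 : ‖va‖ = 0
  · exact ⟨0, by simp [h0]⟩
  by_cases hρ0 : ρ = 0
  -- The flow is along the axis: `cot α` is meaningless and the relation says nothing, but the lift
  -- vanishes and both drags are along `k`.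
  · have hsin : Real.sin α = 0 := by
      have := hsα h0
      rw [hρ0] at this
      exact (mul_eq_zero.1 this).resolve_left h0
    have hCL : V.CL α = 0 := by
      have hα0 : 0 ≤ α := Real.arccos_nonneg _
      rcases (Real.arccos_le_pi (-(inner ℝ va x.k) / ‖va‖)).lt_or_eq with h1 | h1
      · rcases hα0.lt_or_eq with h2 | h2
        · exact absurd hsin (Real.sin_pos_of_pos_of_lt_pi h2 h1).ne'
        · rw [← h2, V.CL_zero]
      · rw [hα, attackAngle, h1, V.CL_pi]
    have ha0 : a = 0 := by rw [← hacos, hρ0, zero_mul]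
    have hb0 : b = 0 := by rw [← hbsin, hρ0, zero_mul]
    rw [hCL]
    refine ⟨(V.ka * CD0 * ‖va‖ - V.ka * ‖va‖ * V.CD α) * c, ?_⟩
    have hva' : va = c • x.k := by rw [hva, ha0, hb0]; simp
    generalize ‖va‖ = n
    rw [hva']
    module
  · have hsin : 0 < Real.sin α := by
      refine lt_of_le_of_ne hsα0 fun h1 => hρ0 ?_
      rw [← hsα h0, ← h1, mul_zero]
    have hα0 : α ∈ Ioo (0 : ℝ) π := by
      refine ⟨lt_of_le_of_ne (Real.arccos_nonneg _) fun h1 => ?_,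
        lt_of_le_of_ne (Real.arccos_le_pi _) fun h1 => ?_⟩
      · rw [← h1, Real.sin_zero] at hsin
        exact lt_irrefl _ hsin
      · rw [h1, Real.sin_pi] at hsin
        exact lt_irrefl _ hsin
    -- The relation times `ρ`, with `cot α = -c / ρ`; it says that the components of the two forces
    -- across the axis agree.
    have hrel : V.CD α * ρ - V.CL α * c = CD0 * ρ := by
      have h1 := h α hα0
      rw [Real.cot_eq_cos_div_sin] at h1
      field_simp at h1
      rw [← hsα h0, ← neg_neg c, ← hcα h0]
      linear_combination ‖va‖ * h1
    refine ⟨V.ka * CD0 * ‖va‖ * c - V.ka * ‖va‖ * V.CD α * c - V.ka * ‖va‖ * V.CL α * ρ, ?_⟩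
    generalize ‖va‖ = n
    rw [hva, ← hacos, ← hbsin]
    have e : V.CL α * c = V.CD α * ρ - CD0 * ρ := by linear_combination -hrel
    have e1 : (V.ka * n * V.CL α) • ((c * Real.cos β) • x.i + (c * Real.sin β) • x.j - ρ • x.k)
        = (V.ka * n * Real.cos β * (V.CL α * c)) • x.i
          + (V.ka * n * Real.sin β * (V.CL α * c)) • x.j - (V.ka * n * V.CL α * ρ) • x.k := by
      module
    rw [e1, e]
    module

end AxisymmetricVehicle

namespace TrackingData

variable {p : ℕ} (D : TrackingData p)

/-- The unknown axial force `s • x.k` enters both `F_a` and `T`, and cancels. The coefficients `CD`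
and `CL`, on which no regularity is assumed, thereby leave the equations of motion. -/
theorem velocity_field_eq (hCD0 : D.veh.SphericalEquivalence D.CD0) (t : ℝ)
    (x : VehicleState p) :
    D.veh.m⁻¹ • (D.veh.m • D.veh.gvec + D.Fa t x - D.thrust t x • x.k)
      = D.ar t + D.ξ (x.rho, x.v - D.vr t) + D.veh.m⁻¹ • (D.FpbarAt t x.rho x.v
          - (inner ℝ (D.FpbarAt t x.rho x.v) x.k : ℝ) • x.k) := by
  obtain ⟨s, hs⟩ := hCD0.exists_aeroForce_eq x (x.v - D.vw t)
  have hm := D.veh.m_pos.ne'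
  have hFa : D.Fa t x = D.FpbarAt t x.rho x.v + s • x.k
      - D.veh.m • (D.veh.gvec - D.ar t - D.ξ (x.rho, x.v - D.vr t)) := by
    rw [Fa, hs, FpbarAt, Fpbar]; abel
  have hT : D.thrust t x = inner ℝ (D.FpbarAt t x.rho x.v) x.k + s := by
    rw [thrust, Fabar, hFa, sub_add_cancel, inner_add_left, inner_smul_left,
      real_inner_self_eq_norm_sq, x.norm_k]
    simp
  rw [hT, hFa, inv_smul_eq_iff₀ hm, smul_add, smul_add, smul_inv_smul₀ hm]
  module

end TrackingData

/-! ### Calculus of norms and directions -/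

section NormSmul

variable {F : Type*} [NormedAddCommGroup F] [InnerProductSpace ℝ F]

/-- At the origin the derivative is `0`, and elsewhere its norm is at most `2 * ‖x‖`, so it is
continuous there too. This makes the drag `C¹` even where the air velocity vanishes. -/
theorem contDiff_norm_smul_self : ContDiff ℝ 1 fun x : F => ‖x‖ • x := by
  rw [contDiff_one_iff_fderiv]
  have h0 : HasFDerivAt (fun x : F => ‖x‖ • x) (0 : F →L[ℝ] F) 0 := by
    rw [hasFDerivAt_iff_isLittleO_nhds_zero]
    have : (fun h : F => ‖h‖ • h) =o[nhds 0] fun h => (1 : ℝ) • h := by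
      refine Asymptotics.IsLittleO.smul_isBigO ?_ (Asymptotics.isBigO_refl _ _)
      rw [Asymptotics.isLittleO_one_iff]
      simpa using (continuous_norm (E := F)).tendsto 0
    simpa using this
  have h1 : ∀ x : F, x ≠ 0 → HasFDerivAt (fun x : F => ‖x‖ • x)
      (‖x‖ • ContinuousLinearMap.id ℝ F + (‖x‖⁻¹ • innerSL ℝ x).smulRight x) x := by
    intro x hx
    have hn : HasFDerivAt (fun x : F => ‖x‖) (‖x‖⁻¹ • innerSL ℝ x) x := by
      have := (hasStrictFDerivAt_norm_sq x).hasFDerivAt.sqrt (by positivity)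
      simp only [Real.sqrt_sq (norm_nonneg _)] at this
      convert this using 1
      ext y
      simp
      field_simp
    exact hn.smul (hasFDerivAt_id x)
  refine ⟨fun x => ?_, continuous_iff_continuousAt.2 fun x => ?_⟩
  · by_cases hx : x = 0
    · rw [hx]; exact h0.differentiableAt
    · exact (h1 x hx).differentiableAt
  by_cases hx : x = 0
  · rw [hx, ContinuousAt, h0.fderiv]
    refine squeeze_zero_norm (a := fun x : F => 2 * ‖x‖) (fun y => ?_) ?_
    · by_cases hy : y = 0
      · rw [hy, h0.fderiv]; simp
      · rw [(h1 y hy).fderiv]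
        refine (norm_add_le _ _).trans ?_
        rw [norm_smul, norm_norm, ContinuousLinearMap.norm_smulRight_apply, norm_smul,
          innerSL_apply_norm, norm_inv, norm_norm, inv_mul_cancel₀ (norm_ne_zero_iff.2 hy)]
        have : ‖ContinuousLinearMap.id ℝ F‖ ≤ 1 := ContinuousLinearMap.norm_id_le
        nlinarith [norm_nonneg y]
    · simpa using (continuous_norm (E := F)).tendsto 0 |>.const_mul 2
  · have : ContinuousAt (fun x : F =>
        ‖x‖ • ContinuousLinearMap.id ℝ F + (‖x‖⁻¹ • innerSL ℝ x).smulRight x) x := by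
      refine (continuous_norm.continuousAt.smul continuousAt_const).add ?_
      have h2 : ContinuousAt (fun x : F => ‖x‖⁻¹ • innerSL ℝ x) x :=
        (continuous_norm.continuousAt.inv₀ (norm_ne_zero_iff.2 hx)).smul
          (innerSL ℝ (E := F)).continuous.continuousAt
      exact ((ContinuousLinearMap.smulRightL ℝ F F).continuous₂.continuousAt).comp
        (h2.prodMk continuousAt_id)
    refine this.congr ?_
    filter_upwards [isOpen_ne.mem_nhds hx] with y hy
    exact (h1 y hy).fderiv.symm

theorem norm_norm_smul_sub_le (a b : F) :
    ‖‖a‖ • a - ‖b‖ • b‖ ≤ (‖a‖ + ‖b‖) * ‖a - b‖ := by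
  have h : ‖a‖ • a - ‖b‖ • b = ‖a‖ • (a - b) + (‖a‖ - ‖b‖) • b := by module
  rw [h]
  refine (norm_add_le _ _).trans ?_
  rw [norm_smul, norm_smul, norm_norm, Real.norm_eq_abs]
  nlinarith [abs_norm_sub_norm_le a b, norm_nonneg b]

/-- Only the reference vector `b` has to be nonzero, so a lower bound along the reference trajectory
suffices for a Lipschitz estimate of directions. -/
theorem norm_inv_norm_smul_sub_le {a b : F} (hb : b ≠ 0) :
    ‖‖a‖⁻¹ • a - ‖b‖⁻¹ • b‖ ≤ 2 * ‖a - b‖ / ‖b‖ := by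
  have hb' : 0 < ‖b‖ := norm_pos_iff.2 hb
  by_cases ha : a = 0
  · rw [ha, le_div_iff₀ hb']
    simp [norm_smul, inv_mul_cancel₀ hb'.ne']
    linarith
  have ha' : 0 < ‖a‖ := norm_pos_iff.2 ha
  have h : ‖a‖⁻¹ • a - ‖b‖⁻¹ • b = ‖b‖⁻¹ • ((a - b) + ((‖b‖ - ‖a‖) * ‖a‖⁻¹) • a) := by
    have : ‖a‖⁻¹ = ‖b‖⁻¹ * (1 + (‖b‖ - ‖a‖) * ‖a‖⁻¹) := by field_simp; ring
    nth_rewrite 1 [this]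
    module
  rw [h, norm_smul, norm_inv, norm_norm, ← div_eq_inv_mul]
  gcongr
  refine (norm_add_le _ _).trans ?_
  rw [norm_smul, norm_mul, norm_inv, norm_norm, mul_assoc, inv_mul_cancel₀ ha'.ne', mul_one,
    Real.norm_eq_abs, abs_sub_comm]
  linarith [abs_norm_sub_norm_le a b]

theorem hasDerivWithinAt_sqrt_add_norm_sq {P : ℝ → F} {P' : F} {I : Set ℝ} {t c : ℝ} (hc : 0 < c)
    (h : HasDerivWithinAt P P' I t) :
    HasDerivWithinAt (fun s => √(c + ‖P s‖ ^ 2)) (inner ℝ (P t) P' / √(c + ‖P t‖ ^ 2)) I t := by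
  convert! (h.norm_sq.const_add c).sqrt (by positivity) using 1
  field_simp

theorem hasDerivWithinAt_inv_norm_smul {P : ℝ → F} {P' : F} {I : Set ℝ} {t : ℝ} (hP : P t ≠ 0)
    (h : HasDerivWithinAt P P' I t) :
    HasDerivWithinAt (fun s => ‖P s‖⁻¹ • P s)
      (‖P t‖⁻¹ • P' - (inner ℝ (P t) P' / ‖P t‖ ^ 3) • P t) I t := by
  have hP' : ‖P t‖ ≠ 0 := norm_ne_zero_iff.2 hP
  have hn : HasDerivWithinAt (fun s => ‖P s‖) (inner ℝ (P t) P' / ‖P t‖) I t := by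
    have := h.norm_sq.sqrt (by positivity)
    simp only [Real.sqrt_sq (norm_nonneg _)] at this
    convert! this using 1
    field_simp
  convert! (hn.inv hP').smul h using 1
  rw [sub_eq_add_neg, ← neg_smul]
  congr 2
  field_simp

end NormSmul

/-! ### Alignment of the thrust direction -/

/-- The decay of `γ² tan² (θ / 2)`, `c = cos θ`, for a thrust direction error `θ` that obeys
`θ' = -(k + γ' / γ) sin θ`. -/
theorem alignment_decay {c γ γ' k : ℝ → ℝ} {t₀ b κ : ℝ}
    (hc : ∀ t ∈ Ico t₀ b,
      HasDerivWithinAt c ((k t + γ' t / γ t) * (1 - c t ^ 2)) (Ico t₀ b) t)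
    (hγ : ∀ t ∈ Ico t₀ b, HasDerivWithinAt γ (γ' t) (Ico t₀ b) t)
    (hγ0 : ∀ t, 0 < γ t) (hk : ∀ t ∈ Ico t₀ b, κ ≤ k t) (hc1 : ∀ t ∈ Ico t₀ b, |c t| ≤ 1)
    (hc0 : -1 < c t₀) : ∀ t ∈ Ico t₀ b, γ t ^ 2 * (1 - c t) ≤
      γ t₀ ^ 2 * (1 - c t₀) / (1 + c t₀) * Real.exp (-2 * κ * (t - t₀)) * (1 + c t) := by
  set W := γ t₀ ^ 2 * (1 - c t₀) / (1 + c t₀) with hW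
  -- Since `(1 - c) / (1 + c) = tan² (θ/2)`, the gain term `γ' / γ` cancels the derivative of `γ²`
  -- and leaves `E' = 2 (κ - k) E ≤ 0`.
  set E : ℝ → ℝ := fun t => Real.exp (2 * κ * (t - t₀)) * (γ t ^ 2 * (1 - c t) / (1 + c t))
    with hE
  -- Cleared of denominators, the estimate passes to the limit at `t₁`, where `c = -1` is not yet
  -- excluded.
  have key : ∀ t₁ ∈ Ico t₀ b, (∀ t ∈ Ico t₀ t₁, -1 < c t) →
      Real.exp (2 * κ * (t₁ - t₀)) * (γ t₁ ^ 2 * (1 - c t₁)) ≤ W * (1 + c t₁) := by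
    intro t₁ ht₁ hpos
    rcases ht₁.1.eq_or_lt with rfl | hlt
    · have : 1 + c t₀ ≠ 0 := by linarith
      rw [hW, div_mul_cancel₀ _ this]
      simp
    have hsub : Ico t₀ t₁ ⊆ Ico t₀ b := Ico_subset_Ico_right ht₁.2.le
    have hder : ∀ t ∈ Ico t₀ t₁,
        HasDerivWithinAt E (2 * (κ - k t) * E t) (Ico t₀ t₁) t := by
      intro t ht
      have hγt := (hγ0 t).ne'
      have hct : 1 + c t ≠ 0 := by linarith [hpos t ht]
      have h1 := (hγ t (hsub ht)).mono hsub
      have h2 := (hc t (hsub ht)).mono hsub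
      have h3 : HasDerivWithinAt (fun t => Real.exp (2 * κ * (t - t₀)))
          (Real.exp (2 * κ * (t - t₀)) * (2 * κ * 1)) (Ico t₀ t₁) t :=
        (((hasDerivWithinAt_id t _).sub_const t₀).const_mul (2 * κ)).exp
      convert! h3.mul (((h1.pow 2).mul (h2.const_sub 1)).div (h2.const_add 1) hct) using 1
      simp only [hE, Pi.mul_apply, Pi.div_apply, Pi.pow_apply]
      field_simp
      ring
    have hanti : AntitoneOn E (Ico t₀ t₁) := by
      refine antitoneOn_of_deriv_nonpos (convex_Ico _ _)
        (fun t ht => (hder t ht).continuousWithinAt) ?_ ?_ <;> rw [interior_Ico]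
      · exact fun t ht => ((hder t (Ioo_subset_Ico_self ht)).mono
          Ioo_subset_Ico_self).differentiableWithinAt
      · intro t ht
        have ht' := Ioo_subset_Ico_self ht
        rw [((hder t ht').hasDerivAt (Ico_mem_nhds ht.1 ht.2)).deriv]
        have h1 := hk t (hsub ht')
        have h2 : 0 ≤ E t := mul_nonneg (Real.exp_pos _).le (div_nonneg
          (mul_nonneg (sq_nonneg _) (by linarith [(abs_le.1 (hc1 t (hsub ht'))).2]))
          (by linarith [hpos t ht']))
        nlinarith
    have hle : ∀ t ∈ Ico t₀ t₁,
        Real.exp (2 * κ * (t - t₀)) * (γ t ^ 2 * (1 - c t)) ≤ W * (1 + c t) := by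
      intro t ht
      have h1 := hanti ⟨le_rfl, hlt⟩ ht ht.1
      have h2 : 0 < 1 + c t := by linarith [hpos t ht]
      simp only [hE, sub_self, mul_zero, Real.exp_zero, one_mul] at h1
      rwa [← mul_div_assoc, div_le_iff₀ h2] at h1
    have hcont : ∀ {f : ℝ → ℝ} {f' : ℝ}, HasDerivWithinAt f f' (Ico t₀ b) t₁ →
        ContinuousWithinAt f (Ico t₀ t₁) t₁ := fun h => h.continuousWithinAt.mono hsub
    have hc' := hcont (hc t₁ ht₁)
    have hγ' := hcont (hγ t₁ ht₁)
    refine ContinuousWithinAt.closure_le (s := Ico t₀ t₁)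
      (f := fun t => Real.exp (2 * κ * (t - t₀)) * (γ t ^ 2 * (1 - c t)))
      (g := fun t => W * (1 + c t)) ?_ ?_ ?_ hle
    · rw [closure_Ico hlt.ne]; exact ⟨hlt.le, le_rfl⟩
    · exact ContinuousWithinAt.mul (by fun_prop)
        ((hγ'.pow 2).mul (continuousWithinAt_const.sub hc'))
    · exact continuousWithinAt_const.mul (continuousWithinAt_const.add hc')
  -- The antipodal direction is never reached: at `c = -1` the estimate `key` would make a positive
  -- quantity at most zero.
  have hpos : ∀ t₁ ∈ Ico t₀ b, ∀ t ∈ Icc t₀ t₁, -c t < 1 := by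
    intro t₁ ht₁
    have hsub : Icc t₀ t₁ ⊆ Ico t₀ b := fun s hs => ⟨hs.1, hs.2.trans_lt ht₁.2⟩
    refine lt_of_continuation (fun t ht => ?_) fun t ht hs => ?_
    · exact ((hc t (hsub ht)).continuousWithinAt.mono hsub).neg
    · have h1 := key t (hsub ht) fun s hs' => by linarith [hs s hs']
      by_contra hcon
      have h2 : c t = -1 := le_antisymm (by linarith) (abs_le.1 (hc1 t (hsub ht))).1
      rw [h2] at h1
      have := hγ0 t
      have : 0 < Real.exp (2 * κ * (t - t₀)) * (γ t ^ 2 * (1 - -1)) := by positivity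
      linarith
  intro t ht
  have h1 := key t ht fun s hs => by linarith [hpos t ht s ⟨hs.1, hs.2.le⟩]
  have h2 : Real.exp (-2 * κ * (t - t₀)) * Real.exp (2 * κ * (t - t₀)) = 1 := by
    rw [← Real.exp_add]; ring_nf; exact Real.exp_zero
  calc γ t ^ 2 * (1 - c t)
      = Real.exp (-2 * κ * (t - t₀)) *
        (Real.exp (2 * κ * (t - t₀)) * (γ t ^ 2 * (1 - c t))) := by
        rw [← mul_assoc, h2, one_mul]
    _ ≤ Real.exp (-2 * κ * (t - t₀)) * (W * (1 + c t)) := by gcongr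
    _ = _ := by ring

namespace AxisymmetricVehicle

variable (V : AxisymmetricVehicle)

theorem equivDrag_eq (CD0 : ℝ) (va : E3) :
    V.equivDrag CD0 va = (-(V.ka * CD0)) • (‖va‖ • va) := by
  rw [equivDrag, smul_smul]; ring_nf

theorem contDiff_equivDrag (CD0 : ℝ) : ContDiff ℝ 1 (V.equivDrag CD0) := by
  rw [funext (V.equivDrag_eq CD0)]
  exact contDiff_norm_smul_self.const_smul _

theorem norm_equivDrag_sub_le (CD0 : ℝ) (u w : E3) :
    ‖V.equivDrag CD0 u - V.equivDrag CD0 w‖ ≤ |V.ka * CD0| * ((‖u‖ + ‖w‖) * ‖u - w‖) := by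
  rw [equivDrag_eq, equivDrag_eq, ← smul_sub, norm_smul, norm_neg, Real.norm_eq_abs]
  exact mul_le_mul_of_nonneg_left (norm_norm_smul_sub_le u w) (abs_nonneg _)

end AxisymmetricVehicle

namespace TrackingData

variable {p : ℕ} (D : TrackingData p)

/-- The derivative of `F̄_p` in the state `(ρ̃, v)` moving with the velocity `(ρ̃', v')`. -/
noncomputable def FpbarDeriv (t : ℝ) (rho : Rho p) (v : E3) (rho' : Rho p) (v' : E3) : E3 :=
  fderiv ℝ (D.veh.equivDrag D.CD0) (v - D.vw t) (v' - deriv D.vw t)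
    + D.veh.m • (-deriv D.ar t - fderiv ℝ D.ξ (rho, v - D.vr t) (rho', v' - D.ar t))

variable {D}

theorem hasDerivWithinAt_FpbarAt (hξ : ContDiff ℝ 1 D.ξ) (hvr : Differentiable ℝ D.vr)
    (har : Differentiable ℝ (deriv D.vr)) (hvw : ContDiff ℝ 1 D.vw) {I : Set ℝ} {t : ℝ}
    {rho : ℝ → Rho p} {v : ℝ → E3} {rho' : Rho p} {v' : E3}
    (hrho : HasDerivWithinAt rho rho' I t) (hv : HasDerivWithinAt v v' I t) :
    HasDerivWithinAt (fun s => D.FpbarAt s (rho s) (v s))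
      (D.FpbarDeriv t (rho t) (v t) rho' v') I t := by
  have h1 := (((D.veh.contDiff_equivDrag D.CD0).differentiable one_ne_zero _).hasFDerivAt
    (x := v t - D.vw t)).comp_hasDerivWithinAt t
    (hv.sub ((hvw.differentiable one_ne_zero t).hasDerivAt.hasDerivWithinAt))
  have h2 := ((hξ.differentiable one_ne_zero _).hasFDerivAt
    (x := (rho t, v t - D.vr t))).comp_hasDerivWithinAt t
    (hrho.prodMk (hv.sub ((hvr t).hasDerivAt.hasDerivWithinAt)))
  have h3 : HasDerivWithinAt D.ar (deriv D.ar t) I t := (har t).hasDerivAt.hasDerivWithinAt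
  have h4 := h1.add (((h3.const_sub D.veh.gvec).sub h2).const_smul D.veh.m)
  exact h4

/-- The angular velocity, apart from the spin about the thrust axis, along a trajectory on which
`F̄_p` takes the value `P` and has the derivative `P'`. -/
theorem omega_eq {I : Set ℝ} {x : ℝ → VehicleState p} {t : ℝ} {P' : E3} (hc₂ : 0 < D.c₂)
    (hI : UniqueDiffWithinAt ℝ I t) (hP : D.FpbarAt t (x t).rho (x t).v ≠ 0)
    (h : HasDerivWithinAt (fun s => D.FpbarAt s (x s).rho (x s).v) P' I t) :
    D.omega I x t = (D.k₁ ((x t).rho, (x t).v, (x t).k, t)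
        + inner ℝ (D.FpbarAt t (x t).rho (x t).v) P' / D.γ t (x t) ^ 2) •
          cross (x t).k (D.kr t (x t))
      + (‖D.FpbarAt t (x t).rho (x t).v‖ ^ 2)⁻¹ • cross (D.FpbarAt t (x t).rho (x t).v) P'
      + D.lam ((x t).rho, (x t).v, (x t).k, t) • (x t).k := by
  have h1 := (hasDerivWithinAt_sqrt_add_norm_sq hc₂ h).derivWithin hI
  have h2 := (hasDerivWithinAt_inv_norm_smul hP h).derivWithin hI
  rw [omega]
  simp only [γ, kr] at h1 h2 ⊢
  rw [h1, h2, div_div, ← sq, sub_eq_add_neg, ← neg_smul, cross_add_right]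
  -- The part of the derivative of `k_r` along `P` disappears in the cross product.
  simp only [cross_smul_left, cross_smul_right, cross_self_eq_zero, smul_zero, add_zero, smul_smul]
  congr 3
  rw [sq, mul_inv]

theorem norm_kr {t : ℝ} {x : VehicleState p} (hP : D.FpbarAt t x.rho x.v ≠ 0) :
    ‖D.kr t x‖ = 1 := by
  rw [kr, norm_smul, norm_inv, norm_norm, inv_mul_cancel₀ (norm_ne_zero_iff.2 hP)]

theorem γ_pos (hc₂ : 0 < D.c₂) (t : ℝ) (x : VehicleState p) : 0 < D.γ t x :=
  Real.sqrt_pos.2 (by positivity)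

/-- The cosine of the thrust direction error obeys `c' = (k₁ + γ' / γ) (1 - c²)`. -/
theorem IsClosedLoopSolution.hasDerivWithinAt_inner {I : Set ℝ} {x : ℝ → VehicleState p}
    (hx : D.IsClosedLoopSolution I x) (hc₂ : 0 < D.c₂) {t : ℝ} (ht : t ∈ I)
    (hI : UniqueDiffWithinAt ℝ I t) {P' : E3}
    (h : HasDerivWithinAt (fun s => D.FpbarAt s (x s).rho (x s).v) P' I t) :
    HasDerivWithinAt (fun s => (inner ℝ (x s).k (D.kr s (x s)) : ℝ))
      ((D.k₁ ((x t).rho, (x t).v, (x t).k, t)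
        + inner ℝ (D.FpbarAt t (x t).rho (x t).v) P' / D.γ t (x t) / D.γ t (x t))
        * (1 - (inner ℝ (x t).k (D.kr t (x t)) : ℝ) ^ 2)) I t := by
  have hP := hx.Fpbar_ne_zero t ht
  have hk := hx.k_eq t ht
  have hkr := hasDerivWithinAt_inv_norm_smul hP h
  have hkr1 := norm_kr hP
  have hn := norm_ne_zero_iff.2 hP
  rw [omega_eq hc₂ hI hP h] at hk
  convert! hk.inner ℝ hkr using 1
  have hkrP : D.kr t (x t)
    = ‖D.FpbarAt t (x t).rho (x t).v‖⁻¹ • D.FpbarAt t (x t).rho (x t).v := rfl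
  rw [← hkrP, div_div, ← sq]
  set P := D.FpbarAt t (x t).rho (x t).v
  have hP_eq : P = ‖P‖ • D.kr t (x t) := by rw [hkrP, smul_inv_smul₀ hn]
  set n := ‖P‖
  set u := D.kr t (x t)
  set k := (x t).k
  have huu : inner ℝ u u = (1 : ℝ) := by rw [real_inner_self_eq_norm_sq, hkr1]; norm_num
  have hkk : inner ℝ k k = (1 : ℝ) := by
    rw [real_inner_self_eq_norm_sq, (x t).norm_k]; norm_num
  generalize inner ℝ P P' / D.γ t (x t) ^ 2 = q
  rw [hP_eq]
  -- The spin `λ k` does not move `k`, the term `ω_r` compensates the motion of `k_r`, and `(k ×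
  -- k_r) × k` has inner product `1 - c²` with `k_r`.
  simp only [cross_add_left, cross_smul_left, cross_self_eq_zero, cross_cross_left, inner_add_left,
    inner_sub_right, inner_sub_left, inner_smul_left, inner_smul_right, huu, hkk,
    smul_zero, inner_zero_left, real_inner_comm k u, real_inner_comm k P', real_inner_comm u P']
  simp only [RCLike.conj_to_real]
  rw [real_inner_comm u k]
  field_simp
  ring

/-- Along the closed loop the thrust direction converges exponentially to the desired one, fast
enough for the resulting force error to converge exponentially as well. -/
theorem IsClosedLoopSolution.alignment_estimate {x : ℝ → VehicleState p} {t₀ b κ : ℝ}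
    (hx : D.IsClosedLoopSolution (Ico t₀ b) x) (ht₀ : 0 ≤ t₀)
    (hξ : ContDiff ℝ 1 D.ξ) (hvr : Differentiable ℝ D.vr)
    (har : Differentiable ℝ (deriv D.vr)) (hvw : ContDiff ℝ 1 D.vw) (hc₂ : 0 < D.c₂)
    (hκ : ∀ q ∈ D.gainDomain, κ ≤ D.k₁ q)
    (h0 : ‖(x t₀).k - D.kr t₀ (x t₀)‖ ≤ 1) : ∀ t ∈ Ico t₀ b,
      ‖D.FpbarAt t (x t).rho (x t).v
          - (inner ℝ (D.FpbarAt t (x t).rho (x t).v) (x t).k : ℝ) • (x t).k‖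
        ≤ 2 * (D.γ t₀ (x t₀) * ‖(x t₀).k - D.kr t₀ (x t₀)‖) * Real.exp (-κ * (t - t₀)) ∧
      √D.c₂ * ‖(x t).k - D.kr t (x t)‖
        ≤ 2 * (D.γ t₀ (x t₀) * ‖(x t₀).k - D.kr t₀ (x t₀)‖) * Real.exp (-κ * (t - t₀)) := by
  intro t ht
  have hder := fun s hs => hasDerivWithinAt_FpbarAt hξ hvr har hvw (hx.rho_eq s hs) (hx.v_eq s hs)
  have hI := uniqueDiffOn_Ico t₀ b
  have hsq : ∀ s ∈ Ico t₀ b, ‖(x s).k - D.kr s (x s)‖ ^ 2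
      = 2 * (1 - inner ℝ (x s).k (D.kr s (x s))) := by
    intro s hs
    rw [norm_sub_sq_real, (x s).norm_k, norm_kr (hx.Fpbar_ne_zero s hs)]
    ring
  have hc1 : ∀ s ∈ Ico t₀ b, |(inner ℝ (x s).k (D.kr s (x s)) : ℝ)| ≤ 1 := by
    intro s hs
    refine (abs_real_inner_le_norm _ _).trans ?_
    rw [(x s).norm_k, norm_kr (hx.Fpbar_ne_zero s hs), one_mul]
  have ht₀b : t₀ ∈ Ico t₀ b := ⟨le_rfl, ht.1.trans_lt ht.2⟩
  have hc0 : (1 : ℝ) / 2 ≤ inner ℝ (x t₀).k (D.kr t₀ (x t₀)) := by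
    have := hsq t₀ ht₀b
    nlinarith [norm_nonneg ((x t₀).k - D.kr t₀ (x t₀))]
  have hdecay := alignment_decay (c := fun s => inner ℝ (x s).k (D.kr s (x s)))
    (γ := fun s => D.γ s (x s)) (κ := κ)
    (fun s hs => hx.hasDerivWithinAt_inner hc₂ hs (hI s hs) (hder s hs))
    (fun s hs => hasDerivWithinAt_sqrt_add_norm_sq hc₂ (hder s hs))
    (fun s => γ_pos hc₂ s (x s))
    (fun s hs => hκ _ ⟨(x s).norm_k, ht₀.trans hs.1, hx.Fpbar_ne_zero s hs⟩) hc1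
    (by linarith) t ht
  have hsqt := hsq t ht
  have hsq0 := hsq t₀ ht₀b
  have hct := abs_le.1 (hc1 t ht)
  have hγ0 := γ_pos hc₂ t₀ (x t₀)
  set w := D.γ t₀ (x t₀) * ‖(x t₀).k - D.kr t₀ (x t₀)‖ with hw
  have hw0 : 0 ≤ w := by positivity
  set e := Real.exp (-κ * (t - t₀)) with he
  have he2 : Real.exp (-2 * κ * (t - t₀)) = e ^ 2 := by
    rw [he, sq, ← Real.exp_add]; ring_nf
  set c := (inner ℝ (x t).k (D.kr t (x t)) : ℝ) with hc
  set c0 := (inner ℝ (x t₀).k (D.kr t₀ (x t₀)) : ℝ)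
  -- From `‖k - k_r‖² = 2 (1 - c0)` and `1 + c0 ≥ 1/2`, the latter because the initial misalignment
  -- is at most 1.
  have hW : D.γ t₀ (x t₀) ^ 2 * (1 - c0) / (1 + c0) ≤ w ^ 2 := by
    rw [div_le_iff₀ (by linarith), hw, mul_pow, hsq0]
    have : 0 ≤ D.γ t₀ (x t₀) ^ 2 * (1 - c0) :=
      mul_nonneg (sq_nonneg _) (by nlinarith [norm_nonneg ((x t₀).k - D.kr t₀ (x t₀))])
    nlinarith
  have hγt : D.γ t (x t) ^ 2 = D.c₂ + ‖D.FpbarAt t (x t).rho (x t).v‖ ^ 2 :=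
    Real.sq_sqrt (by positivity)
  have hmain : D.γ t (x t) ^ 2 * (1 - c) ≤ w ^ 2 * e ^ 2 * (1 + c) := by
    rw [he2] at hdecay
    refine hdecay.trans ?_
    have : 0 ≤ 1 + c := by linarith [hct.1]
    gcongr
  have hc' : 0 ≤ 1 - c := by linarith [hct.2]
  have hwe : 0 ≤ w ^ 2 * e ^ 2 := by positivity
  constructor
  -- The squared force error is `‖F̄_p‖² (1 - c) (1 + c)`. As `‖F̄_p‖ ≤ γ`, the weight `γ²` in the
  -- decaying quantity absorbs the unbounded factor.
  · refine (pow_le_pow_iff_left₀ (norm_nonneg _) (by positivity) two_ne_zero).1 ?_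
    have hPk : (inner ℝ (D.FpbarAt t (x t).rho (x t).v) (x t).k : ℝ)
        = ‖D.FpbarAt t (x t).rho (x t).v‖ * c := by
      rw [hc, kr, inner_smul_right, real_inner_comm, ← mul_assoc,
        mul_inv_cancel₀ (norm_ne_zero_iff.2 (hx.Fpbar_ne_zero t ht)), one_mul]
    rw [norm_sub_sq_real, inner_smul_right, norm_smul, (x t).norm_k, hPk, Real.norm_eq_abs,
      mul_one, sq_abs]
    have : ‖D.FpbarAt t (x t).rho (x t).v‖ ^ 2 ≤ D.γ t (x t) ^ 2 := by rw [hγt]; linarith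
    have h1 : ‖D.FpbarAt t (x t).rho (x t).v‖ ^ 2 * (1 - c) ≤ w ^ 2 * e ^ 2 * (1 + c) :=
      (mul_le_mul_of_nonneg_right this hc').trans hmain
    have h2 := mul_le_mul_of_nonneg_right h1 (show 0 ≤ 1 + c by linarith [hct.1])
    have h3 : (1 + c) * (1 + c) ≤ 4 := by nlinarith [hct.1]
    nlinarith [mul_le_mul_of_nonneg_left h3 hwe]
  · refine (pow_le_pow_iff_left₀ (by positivity) (by positivity) two_ne_zero).1 ?_
    rw [mul_pow, Real.sq_sqrt hc₂.le, hsqt]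
    have : D.c₂ ≤ D.γ t (x t) ^ 2 := by
      rw [hγt]
      exact le_add_of_nonneg_right (sq_nonneg _)
    have h1 := (mul_le_mul_of_nonneg_right this hc').trans hmain
    nlinarith [mul_le_mul_of_nonneg_left (show 1 + c ≤ 2 by linarith) hwe]

end TrackingData

/-! ### Exponential estimate near the reference -/

namespace TrackingData

variable {p : ℕ} {D : TrackingData p}

/-- The vector field of the fully actuated error system. -/
def actuatedField (D : TrackingData p) (y : Rho p × E3) : Rho p × E3 := (D.f y, D.ξ y)

theorem IsFullyActuatedSolution.mono {I J : Set ℝ} {z : ℝ → Rho p × E3}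
    (h : D.IsFullyActuatedSolution I z) (hJ : J ⊆ I) : D.IsFullyActuatedSolution J z :=
  fun t ht => (h t (hJ ht)).mono hJ

/-- The factors 2 convert between the sum of the two norms and the maximum norm of the product. -/
theorem exists_hasExpDecay_actuatedField
    (A1 : UniformlyLocallyExpStable D.IsFullyActuatedSolution (fun _ x => ‖x.1‖ + ‖x.2‖)) :
    ∃ r > 0, ∃ C ≥ 0, ∃ μ > 0, HasExpDecay D.actuatedField r C μ := by
  obtain ⟨μ, hμ, r, hr, C, hC, h⟩ := A1
  refine ⟨r / 2, by positivity, 2 * C, by positivity, μ, hμ, fun τ hτ x₀ hx₀ => ?_⟩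
  have hle : ‖x₀.1‖ + ‖x₀.2‖ ≤ 2 * ‖x₀‖ := by
    linarith [norm_fst_le x₀, norm_snd_le x₀]
  obtain ⟨⟨z, hz, hz0⟩, hest⟩ := h τ hτ x₀ (by linarith)
  refine ⟨z, hz0, fun t ht => ⟨hz t ht, ?_⟩⟩
  have h1 := hest (t + 1) z (hz.mono Ico_subset_Ici_self) hz0 t ⟨ht, by linarith⟩
  have h2 : ‖z t‖ ≤ ‖(z t).1‖ + ‖(z t).2‖ :=
    max_le (le_add_of_nonneg_right (norm_nonneg _)) (le_add_of_nonneg_left (norm_nonneg _))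
  refine (h2.trans h1).trans ?_
  have h3 : 0 ≤ C * Real.exp (-μ * (t - τ)) := by positivity
  nlinarith

/-- The estimate forces the solution from `0` to stay at `0`, so its derivative vanishes; that the
origin is an equilibrium is a consequence of decay. -/
theorem actuatedField_zero {r C μ : ℝ} (hr : 0 < r) (h : HasExpDecay D.actuatedField r C μ) :
    D.actuatedField 0 = 0 := by
  obtain ⟨z, hz0, hz⟩ := h 0 le_rfl 0 (by simpa using hr)
  have hzero : ∀ t ∈ Ici (0 : ℝ), z t = 0 := fun t ht => by
    have := (hz t ht).2
    rwa [norm_zero, mul_zero, norm_le_zero_iff] at this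
  have h1 := (hz 0 self_mem_Ici).1
  have h2 : HasDerivWithinAt z 0 (Ici 0) 0 :=
    (hasDerivWithinAt_const (0 : ℝ) (Ici 0) (0 : Rho p × E3)).congr hzero (hzero 0 self_mem_Ici)
  rw [hz0] at h1
  exact (uniqueDiffOn_Ici (0 : ℝ) 0 self_mem_Ici).eq_deriv _ h1 h2

/-- In a tube of radius `R` around the reference, `F̄_p` is Lipschitz with constant `L` with respect
to the error and has at least the norm `δ / 2`. -/
structure IsRegularTube (D : TrackingData p) (R L δ : ℝ) : Prop where
  R_pos : 0 < R
  L_nonneg : 0 ≤ L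
  δ_pos : 0 < δ
  le_norm_ref : ∀ t, 0 ≤ t → δ ≤ ‖D.FpbarRef t‖
  norm_sub_le : ∀ t, 0 ≤ t → ∀ (rho : Rho p) (v : E3), ‖(rho, v - D.vr t)‖ < R →
    ‖D.FpbarAt t rho v - D.FpbarRef t‖ ≤ L * ‖(rho, v - D.vr t)‖
  le_norm : ∀ t, 0 ≤ t → ∀ (rho : Rho p) (v : E3), ‖(rho, v - D.vr t)‖ < R →
    δ / 2 ≤ ‖D.FpbarAt t rho v‖

/-- The acceleration `a_r` cancels in the difference, and boundedness of `v_r - v_w` makes the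
quadratic drag Lipschitz uniformly in time; no bound on `a_r` is needed. -/
theorem exists_isRegularTube {K : NNReal} {R₀ δ B : ℝ} (hR₀ : 0 < R₀)
    (hK : LipschitzOnWith K D.actuatedField (Metric.ball 0 R₀)) (h0 : D.actuatedField 0 = 0)
    (hB : ∀ t : ℝ, 0 ≤ t → ‖D.vr t - D.vw t‖ ≤ B) (hδ : 0 < δ)
    (A2 : ∀ t : ℝ, 0 ≤ t → δ ≤ ‖D.FpbarRef t‖) : ∃ R L, D.IsRegularTube R L δ := by
  have hB0 : 0 ≤ B := (norm_nonneg _).trans (hB 0 le_rfl)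
  have hm := D.veh.m_pos
  set L := |D.veh.ka * D.CD0| * (2 * B + 1) + D.veh.m * K with hL
  have hL0 : 0 ≤ L := by positivity
  have hlip : ∀ t, 0 ≤ t → ∀ (rho : Rho p) (v : E3), ‖(rho, v - D.vr t)‖ < min R₀ 1 →
      ‖D.FpbarAt t rho v - D.FpbarRef t‖ ≤ L * ‖(rho, v - D.vr t)‖ := by
    intro t ht rho v hy
    set y : Rho p × E3 := (rho, v - D.vr t) with hydef
    have hw : ‖v - D.vr t‖ ≤ ‖y‖ := norm_snd_le y
    have hy1 : ‖y‖ < 1 := hy.trans_le (min_le_right _ _)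
    have hξ : ‖D.ξ y‖ ≤ K * ‖y‖ := by
      have h1 := hK.norm_sub_le (x := y) (y := 0)
        (by simpa using hy.trans_le (min_le_left _ _)) (by simpa using hR₀)
      rw [h0, sub_zero, sub_zero] at h1
      exact (norm_snd_le (D.actuatedField y)).trans h1
    have heq : D.FpbarAt t rho v - D.FpbarRef t
        = (D.veh.equivDrag D.CD0 (v - D.vw t) - D.veh.equivDrag D.CD0 (D.vr t - D.vw t))
          - D.veh.m • D.ξ y := by
      rw [FpbarAt, FpbarRef, Fpbar, Fpbar]
      module
    rw [heq]
    refine (_root_.norm_sub_le _ _).trans ?_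
    have h1 := D.veh.norm_equivDrag_sub_le D.CD0 (v - D.vw t) (D.vr t - D.vw t)
    rw [sub_sub_sub_cancel_right] at h1
    have h2 : ‖v - D.vw t‖ ≤ 1 + B := by
      have : v - D.vw t = (v - D.vr t) + (D.vr t - D.vw t) := by abel
      rw [this]
      refine (norm_add_le _ _).trans (add_le_add (hw.trans hy1.le) (hB t ht))
    have h3 : (‖v - D.vw t‖ + ‖D.vr t - D.vw t‖) * ‖v - D.vr t‖ ≤ (2 * B + 1) * ‖y‖ :=
      mul_le_mul (by linarith [hB t ht]) hw (norm_nonneg _) (by positivity)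
    have h4 := mul_le_mul_of_nonneg_left h3 (abs_nonneg (D.veh.ka * D.CD0))
    rw [norm_smul, Real.norm_of_nonneg hm.le]
    have h5 := mul_le_mul_of_nonneg_left hξ hm.le
    rw [hL]
    linarith
  -- Within `δ / (2 * (L + 1))` the deviation of `F̄_p` is at most `δ / 2`, half its lower bound on
  -- the reference.
  refine ⟨min (min R₀ 1) (δ / (2 * (L + 1))), L, by positivity, hL0, hδ, A2,
    fun t ht rho v hy => hlip t ht rho v (hy.trans_le (min_le_left _ _)), fun t ht rho v hy => ?_⟩
  have h1 := hlip t ht rho v (hy.trans_le (min_le_left _ _))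
  have h2 := hy.trans_le (min_le_right _ _)
  rw [lt_div_iff₀ (by positivity)] at h2
  have h3 : ‖D.FpbarRef t‖ ≤ ‖D.FpbarAt t rho v‖ + ‖D.FpbarAt t rho v - D.FpbarRef t‖ :=
    norm_le_norm_add_norm_sub _ _
  have h4 := A2 t ht
  have h5 := norm_nonneg (rho, v - D.vr t)
  linarith

theorem IsRegularTube.norm_kr_sub_le {R L δ : ℝ} (h : D.IsRegularTube R L δ) {t : ℝ} (ht : 0 ≤ t)
    {x : VehicleState p} (hx : ‖(x.rho, x.v - D.vr t)‖ < R) :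
    ‖D.kr t x - D.kRef t‖ ≤ 2 * L / δ * ‖(x.rho, x.v - D.vr t)‖ := by
  have h1 := h.le_norm_ref t ht
  have h2 := h.norm_sub_le t ht _ _ hx
  have hδ := h.δ_pos
  have hL := h.L_nonneg
  have h3 : D.FpbarRef t ≠ 0 := norm_pos_iff.1 (hδ.trans_le h1)
  refine (norm_inv_norm_smul_sub_le h3).trans ?_
  calc 2 * ‖D.FpbarAt t x.rho x.v - D.FpbarRef t‖ / ‖D.FpbarRef t‖
      ≤ 2 * (L * ‖(x.rho, x.v - D.vr t)‖) / δ := by gcongr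
    _ = _ := by ring

theorem closedLoopError_nonneg (t : ℝ) (x : VehicleState p) : 0 ≤ D.closedLoopError t x := by
  unfold closedLoopError; positivity

theorem norm_le_closedLoopError (t : ℝ) (x : VehicleState p) :
    ‖(x.rho, x.v - D.vr t)‖ ≤ D.closedLoopError t x := by
  have h1 := norm_nonneg x.rho
  have h2 := norm_nonneg (x.v - D.vr t)
  have h3 := norm_nonneg (x.k - D.kRef t)
  rw [closedLoopError, Prod.norm_mk]
  exact max_le (by linarith) (by linarith)

/-- The velocity error obeys the fully actuated system up to the force error due to the
misalignment of the thrust. -/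
theorem IsClosedLoopSolution.hasDerivWithinAt_error {I : Set ℝ} {x : ℝ → VehicleState p}
    (hx : D.IsClosedLoopSolution I x) (hCD0 : D.veh.SphericalEquivalence D.CD0)
    (hvr : Differentiable ℝ D.vr) {t : ℝ} (ht : t ∈ I) :
    HasDerivWithinAt (fun s => ((x s).rho, (x s).v - D.vr s))
      (D.actuatedField ((x t).rho, (x t).v - D.vr t) + (0, D.veh.m⁻¹ •
        (D.FpbarAt t (x t).rho (x t).v
          - (inner ℝ (D.FpbarAt t (x t).rho (x t).v) (x t).k : ℝ) • (x t).k))) I t := by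
  have hv := (hx.v_eq t ht).sub (hvr t).hasDerivAt.hasDerivWithinAt
  rw [velocity_field_eq D hCD0] at hv
  convert! (hx.rho_eq t ht).prodMk hv using 1
  rw [actuatedField, Prod.mk_add_mk, add_zero, ar]
  congr 1
  abel

/-- Every solution of the closed loop obeys an exponential estimate. -/
theorem exists_closedLoop_estimate (hCD0 : D.veh.SphericalEquivalence D.CD0)
    (hξ : ContDiff ℝ 1 D.ξ) (hvr : Differentiable ℝ D.vr) (har : Differentiable ℝ (deriv D.vr))
    (hvw : ContDiff ℝ 1 D.vw) (hc₂ : 0 < D.c₂) {κ : ℝ} (hκ0 : 0 < κ)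
    (hκ : ∀ q ∈ D.gainDomain, κ ≤ D.k₁ q) {r₁ C₁ μ₁ : ℝ} (hr₁ : 0 < r₁) (hC₁ : 0 ≤ C₁)
    (hμ₁ : 0 < μ₁) (hdecay : HasExpDecay D.actuatedField r₁ C₁ μ₁) {K : NNReal} {R₀ : ℝ}
    (hR₀ : 0 < R₀) (hK : LipschitzOnWith K D.actuatedField (Metric.ball 0 R₀)) {R L δ : ℝ}
    (htube : D.IsRegularTube R L δ) :
    ∃ μ > 0, ∀ Γ : ℝ, ∃ r > 0, ∃ C > 0, ∀ t₀ : ℝ, 0 ≤ t₀ → ‖D.FpbarRef t₀‖ ≤ Γ →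
      ∀ (b : ℝ) (x : ℝ → VehicleState p), D.IsClosedLoopSolution (Ico t₀ b) x →
      D.closedLoopError t₀ (x t₀) < r → ∀ t ∈ Ico t₀ b,
        D.closedLoopError t (x t)
          ≤ C * Real.exp (-μ * (t - t₀)) * D.closedLoopError t₀ (x t₀) := by
  obtain ⟨μ, hμ, hμκ, r', hr', C', hC', hest⟩ :=
    hdecay.exists_of_perturbation hr₁ hμ₁ hC₁ hR₀ hK hκ0
  -- The rate is fixed before `Γ`, which affects only the size of the perturbation and hence only
  -- `r` and `C`.
  refine ⟨μ, hμ, fun Γ => ?_⟩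
  have hR := htube.R_pos
  have hL := htube.L_nonneg
  have hδ := htube.δ_pos
  have hm := D.veh.m_pos
  have hsc := Real.sqrt_pos.2 hc₂
  -- In terms of the initial error `e`: `A * e` bounds the misalignment `k - k_r`, `G` bounds the
  -- initial `γ`, and `H * e` bounds the initial value together with the size of the perturbation.
  set A := 1 + 2 * L / δ with hA
  set G := √D.c₂ + |Γ| + L * R with hG
  set H := 1 + 2 * G * A / D.veh.m with hH
  have hA0 : 0 < A := by positivity
  have hG0 : 0 < G := by positivity
  have hH0 : 0 < H := by positivity
  clear_value A G H
  -- The four conditions give `A * e < 1` for `alignment_estimate`, a start in the tube, the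
  -- smallness required by `hest`, and a trajectory that stays in the tube.
  refine ⟨min (min (1 / A) R) (min (r' / H) (R / (C' * H))), by positivity,
    (2 + 2 * L / δ) * (C' * H) + 2 * G * A / √D.c₂, by positivity, ?_⟩
  intro t₀ ht₀ hΓ b x hx hsmall t ht
  set e := D.closedLoopError t₀ (x t₀) with he
  have he0 : 0 ≤ e := closedLoopError_nonneg _ _
  rw [lt_min_iff, lt_min_iff, lt_min_iff, lt_div_iff₀ hA0, lt_div_iff₀ hH0,
    lt_div_iff₀ (by positivity)] at hsmall
  obtain ⟨⟨hs1, hs2⟩, hs3, hs4⟩ := hsmall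
  set y : ℝ → Rho p × E3 := fun s => ((x s).rho, (x s).v - D.vr s) with hy
  have hy0 : ‖y t₀‖ ≤ e := norm_le_closedLoopError t₀ (x t₀)
  have hy0R : ‖y t₀‖ < R := hy0.trans_lt hs2
  have hk0 : ‖(x t₀).k - D.kr t₀ (x t₀)‖ ≤ A * e := by
    have h1 := htube.norm_kr_sub_le ht₀ hy0R
    have h2 : ‖(x t₀).k - D.kRef t₀‖ ≤ e := by
      rw [he, closedLoopError]
      have := norm_nonneg (x t₀).rho
      have := norm_nonneg ((x t₀).v - D.vr t₀)
      linarith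
    have h3 := norm_sub_le_norm_sub_add_norm_sub (x t₀).k (D.kRef t₀) (D.kr t₀ (x t₀))
    rw [norm_sub_rev (D.kRef t₀)] at h3
    have h4 : 2 * L / δ * ‖y t₀‖ ≤ 2 * L / δ * e := by gcongr
    rw [hA]
    linarith
  have hγ0 : D.γ t₀ (x t₀) ≤ G := by
    have h1 := htube.norm_sub_le t₀ ht₀ _ _ hy0R
    have h2 : ‖D.FpbarAt t₀ (x t₀).rho (x t₀).v‖ ≤ |Γ| + L * R := by
      have h3 := norm_le_norm_add_norm_sub' (D.FpbarAt t₀ (x t₀).rho (x t₀).v) (D.FpbarRef t₀)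
      have h4 : L * ‖y t₀‖ ≤ L * R := by gcongr
      have := le_abs_self Γ
      linarith
    have h3 : D.γ t₀ (x t₀) ≤ √D.c₂ + ‖D.FpbarAt t₀ (x t₀).rho (x t₀).v‖ := by
      have := norm_nonneg (D.FpbarAt t₀ (x t₀).rho (x t₀).v)
      refine Real.sqrt_le_iff.2 ⟨by positivity, ?_⟩
      nlinarith [Real.sq_sqrt hc₂.le]
    linarith
  have halign := hx.alignment_estimate ht₀ hξ hvr har hvw hc₂ hκ (by linarith)
  set w := D.γ t₀ (x t₀) * ‖(x t₀).k - D.kr t₀ (x t₀)‖ with hw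
  have hwle : w ≤ G * A * e := by
    rw [mul_assoc]
    exact mul_le_mul hγ0 hk0 (norm_nonneg _) hG0.le
  have hw0 : 0 ≤ w := mul_nonneg (γ_pos hc₂ _ _).le (norm_nonneg _)
  have hbound : ∀ s ∈ Ico t₀ b, ‖y s‖ ≤ C' * Real.exp (-μ * (s - t₀)) * (H * e) := by
    have h1 : ‖y t₀‖ + D.veh.m⁻¹ * (2 * w) ≤ H * e := by
      have h2 : D.veh.m⁻¹ * (2 * w) ≤ D.veh.m⁻¹ * (2 * (G * A * e)) := by gcongr
      have h3 : H * e = e + D.veh.m⁻¹ * (2 * (G * A * e)) := by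
        rw [hH]; field_simp
      linarith
    intro s hs
    refine (hest t₀ ht₀ b (D.veh.m⁻¹ * (2 * w)) y _
      (fun s hs => hx.hasDerivWithinAt_error hCD0 hvr hs) (fun s hs => ?_) (by linarith)
      s hs).trans ?_
    · rw [Prod.norm_mk, norm_zero, max_eq_right (norm_nonneg _), norm_smul, norm_inv,
        Real.norm_of_nonneg hm.le, mul_assoc]
      exact mul_le_mul_of_nonneg_left (halign s hs).1 (by positivity)
    · gcongr
  have hyt := hbound t ht
  clear_value w e
  set E := Real.exp (-μ * (t - t₀)) with hE
  have hE0 : 0 < E := Real.exp_pos _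
  have hE1 : E ≤ 1 := Real.exp_le_one_iff.2 (by
    linarith [mul_nonneg hμ.le (sub_nonneg.2 ht.1)])
  have hytR : ‖y t‖ < R := by
    have : C' * E * (H * e) ≤ C' * 1 * (H * e) := by gcongr
    linarith
  have hμt : 0 ≤ (κ - μ) * (t - t₀) := mul_nonneg (by linarith) (by linarith [ht.1])
  have hkt : ‖(x t).k - D.kr t (x t)‖ ≤ 2 * G * A / √D.c₂ * E * e := by
    have h1 := (halign t ht).2
    have h2 : Real.exp (-κ * (t - t₀)) ≤ E :=
      Real.exp_le_exp.2 (by linarith)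
    have h3 : 2 * w * Real.exp (-κ * (t - t₀)) ≤ 2 * (G * A * e) * E := by gcongr
    rw [show 2 * G * A / √D.c₂ * E * e = (2 * (G * A * e) * E) / √D.c₂ by ring,
      le_div_iff₀ hsc]
    linarith
  have hkr := htube.norm_kr_sub_le (t := t) (x := x t) (ht₀.trans ht.1) hytR
  have h1 := norm_sub_le_norm_sub_add_norm_sub (x t).k (D.kr t (x t)) (D.kRef t)
  have h2 : ‖(x t).rho‖ ≤ ‖y t‖ := norm_fst_le (y t)
  have h3 : ‖(x t).v - D.vr t‖ ≤ ‖y t‖ := norm_snd_le (y t)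
  have h4 : (2 + 2 * L / δ) * ‖y t‖ ≤ (2 + 2 * L / δ) * (C' * E * (H * e)) := by gcongr
  rw [closedLoopError]
  change ‖D.kr t (x t) - D.kRef t‖ ≤ 2 * L / δ * ‖y t‖ at hkr
  linarith

end TrackingData

/-! ### Tools for existence: extension, cut-off fields, rotating frames -/

/-- Tietze's theorem; it extends the gains beyond the region where the feedback law makes sense. -/
theorem ContinuousOn.exists_continuous_eqOn {X : Type*} [TopologicalSpace X] [NormalSpace X]
    {f : X → ℝ} {S : Set X} (hf : ContinuousOn f S) (hS : IsClosed S) :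
    ∃ g : X → ℝ, Continuous g ∧ EqOn g f S := by
  obtain ⟨g, hg⟩ := ContinuousMap.exists_restrict_eq hS ⟨S.domRestrict f, hf.domRestrict⟩
  exact ⟨g, g.continuous, fun q hq => congrArg (fun h : C(S, ℝ) => h ⟨q, hq⟩) hg⟩

section Components

variable {E F : Type*} [NormedAddCommGroup E] [NormedSpace ℝ E] [NormedAddCommGroup F]
  [NormedSpace ℝ F] {f : ℝ → E × F} {f' : E × F} {I : Set ℝ} {t : ℝ}

theorem HasDerivWithinAt.fst (h : HasDerivWithinAt f f' I t) :
    HasDerivWithinAt (fun s => (f s).1) f'.1 I t :=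
  (ContinuousLinearMap.fst ℝ E F).hasFDerivAt.comp_hasDerivWithinAt t h

theorem HasDerivWithinAt.snd (h : HasDerivWithinAt f f' I t) :
    HasDerivWithinAt (fun s => (f s).2) f'.2 I t :=
  (ContinuousLinearMap.snd ℝ E F).hasFDerivAt.comp_hasDerivWithinAt t h

end Components

/-- Peano's existence theorem on a half-line for a vector field cut off outside of a ball. -/
theorem exists_hasDerivWithinAt_Ici_of_comp {E : Type*} [NormedAddCommGroup E] [NormedSpace ℝ E]
    [ProperSpace E] {F : ℝ → E → E} (hF : Continuous fun q : ℝ × E => F q.1 q.2) {cut : E → E}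
    (hcut : Continuous cut) {R : ℝ} (hR : ∀ z, ‖cut z‖ ≤ R) (t₀ : ℝ) (x₀ : E) :
    ∃ x : ℝ → E, x t₀ = x₀ ∧
      ∀ t ∈ Ici t₀, HasDerivWithinAt x (F t (cut (x t))) (Ici t₀) t := by
  refine exists_hasDerivWithinAt_Ici_of_continuous (F := fun t z => F t (cut z))
    (hF.comp (continuous_fst.prodMk (hcut.comp continuous_snd))) (fun N => ?_) x₀
  obtain ⟨M, hM⟩ := IsCompact.exists_bound_of_continuousOn
    (s := Icc t₀ N ×ˢ Metric.closedBall (0 : E) R)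
    (isCompact_Icc.prod (isCompact_closedBall (0 : E) R)) hF.continuousOn
  exact ⟨M, fun t ht y => hM (t, cut y) ⟨ht, mem_closedBall_zero_iff.2 (hR y)⟩⟩

section RigidRotation

theorem eq_of_hasDerivWithinAt_zero {f : ℝ → ℝ} {t₀ : ℝ}
    (h : ∀ t ∈ Ici t₀, HasDerivWithinAt f 0 (Ici t₀) t) : ∀ t ∈ Ici t₀, f t = f t₀ := fun t ht =>
  constant_of_has_deriv_right_zero
    (fun s hs => (h s hs.1).continuousWithinAt.mono Icc_subset_Ici_self)
    (fun s hs => (h s hs.1).mono (Ici_subset_Ici.2 hs.1)) t ⟨ht, le_rfl⟩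

theorem HasDerivWithinAt.apply_coord {u : ℝ → E3} {u' : E3} {I : Set ℝ} {t : ℝ}
    (h : HasDerivWithinAt u u' I t) (n : Fin 3) :
    HasDerivWithinAt (fun s => u s n) (u' n) I t :=
  (EuclideanSpace.proj (𝕜 := ℝ) (ι := Fin 3) n).hasFDerivAt.comp_hasDerivWithinAt t h

/-- The cut-off vector is a multiple of `u`, so the velocity is orthogonal to `u` even where the
cut-off acts. This is how the cut-off on the frame is seen to be inactive. -/
theorem norm_eq_of_rotation {u ω : ℝ → E3} {t₀ R : ℝ}
    (h : ∀ t ∈ Ici t₀, HasDerivWithinAt u (cross (ω t) (clip R (u t))) (Ici t₀) t) :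
    ∀ t ∈ Ici t₀, ‖u t‖ = ‖u t₀‖ := by
  intro t ht
  have h1 := eq_of_hasDerivWithinAt_zero (f := fun s => ‖u s‖ ^ 2) (fun s hs => by
    convert! (h s hs).norm_sq using 1
    rw [clip, cross_smul_right, inner_smul_right, real_inner_comm, inner_cross_self_right]
    simp) t ht
  exact (pow_left_inj₀ (norm_nonneg _) (norm_nonneg _) two_ne_zero).1 h1

theorem inner_eq_of_rotation {u w ω : ℝ → E3} {t₀ : ℝ}
    (hu : ∀ t ∈ Ici t₀, HasDerivWithinAt u (cross (ω t) (u t)) (Ici t₀) t)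
    (hw : ∀ t ∈ Ici t₀, HasDerivWithinAt w (cross (ω t) (w t)) (Ici t₀) t) :
    ∀ t ∈ Ici t₀, (inner ℝ (u t) (w t) : ℝ) = inner ℝ (u t₀) (w t₀) :=
  eq_of_hasDerivWithinAt_zero (f := fun s => (inner ℝ (u s) (w s) : ℝ)) fun s hs => by
    convert! (hu s hs).inner ℝ (hw s hs) using 1
    rw [inner_cross_swap, real_inner_comm]
    ring

/-- An infinitesimal rotation has trace zero, so it preserves the determinant; this keeps the frame
direct. -/
theorem inner_cross_eq_of_rotation {u w z ω : ℝ → E3} {t₀ : ℝ}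
    (hu : ∀ t ∈ Ici t₀, HasDerivWithinAt u (cross (ω t) (u t)) (Ici t₀) t)
    (hw : ∀ t ∈ Ici t₀, HasDerivWithinAt w (cross (ω t) (w t)) (Ici t₀) t)
    (hz : ∀ t ∈ Ici t₀, HasDerivWithinAt z (cross (ω t) (z t)) (Ici t₀) t) :
    ∀ t ∈ Ici t₀, (inner ℝ (cross (u t) (w t)) (z t) : ℝ)
      = inner ℝ (cross (u t₀) (w t₀)) (z t₀) := by
  refine eq_of_hasDerivWithinAt_zero (f := fun s => (inner ℝ (cross (u s) (w s)) (z s) : ℝ))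
    fun s hs => ?_
  have hu := fun n => (hu s hs).apply_coord n
  have hw := fun n => (hw s hs).apply_coord n
  have hz := fun n => (hz s hs).apply_coord n
  simp only [inner_eq_coord, cross_eq_coord] at hu hw hz ⊢
  convert! (((((hu 1).mul (hw 2)).sub ((hu 2).mul (hw 1))).mul (hz 0)).add
    ((((hu 2).mul (hw 0)).sub ((hu 0).mul (hw 2))).mul (hz 1))).add
    ((((hu 0).mul (hw 1)).sub ((hu 1).mul (hw 0))).mul (hz 2)) using 1
  simp
  ring

/-- A direct orthonormal frame remains one under a rotation. -/
theorem orthonormal_of_rotation {i j k ω : ℝ → E3} {t₀ R : ℝ} (hR : 1 ≤ R)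
    (hi : ∀ t ∈ Ici t₀, HasDerivWithinAt i (cross (ω t) (clip R (i t))) (Ici t₀) t)
    (hj : ∀ t ∈ Ici t₀, HasDerivWithinAt j (cross (ω t) (clip R (j t))) (Ici t₀) t)
    (hk : ∀ t ∈ Ici t₀, HasDerivWithinAt k (cross (ω t) (clip R (k t))) (Ici t₀) t)
    (h0 : Orthonormal ℝ ![i t₀, j t₀, k t₀]) (hd : cross (i t₀) (j t₀) = k t₀) :
    ∀ t ∈ Ici t₀, Orthonormal ℝ ![i t, j t, k t] ∧ cross (i t) (j t) = k t := by
  have hR0 : 0 < R := by linarith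
  have key : ∀ u : ℝ → E3, ‖u t₀‖ = 1 →
      (∀ t ∈ Ici t₀, HasDerivWithinAt u (cross (ω t) (clip R (u t))) (Ici t₀) t) →
      (∀ t ∈ Ici t₀, ‖u t‖ = 1) ∧
      ∀ t ∈ Ici t₀, HasDerivWithinAt u (cross (ω t) (u t)) (Ici t₀) t := by
    intro u hu0 hu
    have h1 : ∀ t ∈ Ici t₀, ‖u t‖ = 1 := fun t ht => (norm_eq_of_rotation hu t ht).trans hu0
    refine ⟨h1, fun t ht => ?_⟩
    have := hu t ht
    rwa [clip_of_norm_le hR0 ((h1 t ht).trans_le hR)] at this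
  obtain ⟨hi1, hi⟩ := key i (h0.1 0) hi
  obtain ⟨hj1, hj⟩ := key j (h0.1 1) hj
  obtain ⟨hk1, hk⟩ := key k (h0.1 2) hk
  intro t ht
  have hij : inner ℝ (i t) (j t) = (0 : ℝ) := (inner_eq_of_rotation hi hj t ht).trans
    (h0.2 (show (0 : Fin 3) ≠ 1 by decide))
  have hik : inner ℝ (i t) (k t) = (0 : ℝ) := (inner_eq_of_rotation hi hk t ht).trans
    (h0.2 (show (0 : Fin 3) ≠ 2 by decide))
  have hjk : inner ℝ (j t) (k t) = (0 : ℝ) := (inner_eq_of_rotation hj hk t ht).trans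
    (h0.2 (show (1 : Fin 3) ≠ 2 by decide))
  constructor
  · constructor
    · intro n
      fin_cases n
      exacts [hi1 t ht, hj1 t ht, hk1 t ht]
    · intro n n' hn
      fin_cases n <;> fin_cases n' <;> simp_all [real_inner_comm]
  -- `i × j` and `k` are unit vectors with inner product 1, hence equal.
  · have h1 := inner_cross_eq_of_rotation hi hj hk t ht
    have hk0 : ‖k t₀‖ = 1 := h0.1 2
    rw [hd, real_inner_self_eq_norm_sq, hk0] at h1
    have h2 : ‖cross (i t) (j t)‖ ^ 2 = 1 := by
      rw [← real_inner_self_eq_norm_sq, inner_cross_swap, cross_cross_right, inner_sub_left,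
        inner_smul_left, inner_smul_left, hij, real_inner_self_eq_norm_sq,
        real_inner_self_eq_norm_sq, hi1 t ht, hj1 t ht]
      simp
    rw [← sub_eq_zero, ← norm_eq_zero, ← sq_eq_zero_iff, norm_sub_sq_real, h1, h2, hk1 t ht]
    norm_num

end RigidRotation

/-! ### Global solutions of the extended closed loop -/

namespace TrackingData

variable {p : ℕ}

/-- The acceleration of the vehicle in closed loop. -/
noncomputable def accel (D : TrackingData p) (t : ℝ) (rho : Rho p) (v k : E3) : E3 :=
  D.ar t + D.ξ (rho, v - D.vr t) + D.veh.m⁻¹ • (D.FpbarAt t rho v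
    - (inner ℝ (D.FpbarAt t rho v) k : ℝ) • k)

/-- The closed-loop derivative of `F̄_p`. -/
noncomputable def FpbarVel (D : TrackingData p) (t : ℝ) (rho : Rho p) (v k : E3) : E3 :=
  D.FpbarDeriv t rho v (D.f (rho, v - D.vr t)) (D.accel t rho v k)

/-- The angular velocity in closed loop, with gains `g₁` and `g₂`, and with the singularity of the
feedback law at `F̄_p = 0` removed. -/
noncomputable def angVel (D : TrackingData p) (η : ℝ) (g₁ g₂ : Rho p × E3 × E3 × ℝ → ℝ) (t : ℝ)
    (rho : Rho p) (v k : E3) : E3 :=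
  (g₁ (rho, v, k, t) + inner ℝ (D.FpbarAt t rho v) (D.FpbarVel t rho v k)
      / (D.c₂ + ‖D.FpbarAt t rho v‖ ^ 2)) •
        cross k ((max ‖D.FpbarAt t rho v‖ η)⁻¹ • D.FpbarAt t rho v)
    + ((max ‖D.FpbarAt t rho v‖ η) ^ 2)⁻¹ • cross (D.FpbarAt t rho v) (D.FpbarVel t rho v k)
    + g₂ (rho, v, k, t) • k

/-- The vector field of the closed loop in the variables `((ρ̃, ṽ), i, j, k)`. -/
noncomputable def loopField (D : TrackingData p) (η : ℝ) (g₁ g₂ : Rho p × E3 × E3 × ℝ → ℝ) (t : ℝ)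
    (z : (Rho p × E3) × E3 × E3 × E3) : (Rho p × E3) × E3 × E3 × E3 :=
  ((D.f z.1, D.accel t z.1.1 (z.1.2 + D.vr t) z.2.2.2 - D.ar t),
    cross (D.angVel η g₁ g₂ t z.1.1 (z.1.2 + D.vr t) z.2.2.2) z.2.1,
    cross (D.angVel η g₁ g₂ t z.1.1 (z.1.2 + D.vr t) z.2.2.2) z.2.2.1,
    cross (D.angVel η g₁ g₂ t z.1.1 (z.1.2 + D.vr t) z.2.2.2) z.2.2.2)

variable {D : TrackingData p}

section Continuity

variable {X : Type*} [TopologicalSpace X] {τ : X → ℝ} {rho : X → Rho p} {v k : X → E3}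

theorem continuous_FpbarAt (hξ : ContDiff ℝ 1 D.ξ) (hvr : Differentiable ℝ D.vr)
    (har : Differentiable ℝ (deriv D.vr)) (hvw : ContDiff ℝ 1 D.vw) (hτ : Continuous τ)
    (hrho : Continuous rho) (hv : Continuous v) :
    Continuous fun q => D.FpbarAt (τ q) (rho q) (v q) := by
  have h1 : Continuous D.ar := har.continuous
  have h2 := hvr.continuous
  have h3 := hvw.continuous
  have h4 := (D.veh.contDiff_equivDrag D.CD0).continuous
  have h5 := hξ.continuous
  unfold FpbarAt Fpbar
  fun_prop

theorem continuous_accel (hξ : ContDiff ℝ 1 D.ξ) (hvr : Differentiable ℝ D.vr)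
    (har : Differentiable ℝ (deriv D.vr)) (hvw : ContDiff ℝ 1 D.vw) (hτ : Continuous τ)
    (hrho : Continuous rho) (hv : Continuous v) (hk : Continuous k) :
    Continuous fun q => D.accel (τ q) (rho q) (v q) (k q) := by
  have h1 : Continuous D.ar := har.continuous
  have h2 := hvr.continuous
  have h5 := hξ.continuous
  have h6 := continuous_FpbarAt hξ hvr har hvw hτ hrho hv
  unfold accel
  fun_prop

theorem continuous_FpbarVel (hf : ContDiff ℝ 1 D.f) (hξ : ContDiff ℝ 1 D.ξ)
    (hvr : Differentiable ℝ D.vr) (har : Differentiable ℝ (deriv D.vr))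
    (har' : Differentiable ℝ (deriv (deriv D.vr))) (hvw : ContDiff ℝ 1 D.vw) (hτ : Continuous τ)
    (hrho : Continuous rho) (hv : Continuous v) (hk : Continuous k) :
    Continuous fun q => D.FpbarVel (τ q) (rho q) (v q) (k q) := by
  have h1 : Continuous D.ar := har.continuous
  have h1' : Continuous (deriv D.ar) := har'.continuous
  have h2 := hvr.continuous
  have h3 := hvw.continuous
  have h3' := hvw.continuous_deriv le_rfl
  have h4 := (D.veh.contDiff_equivDrag D.CD0).continuous_fderiv one_ne_zero
  have h5 := hξ.continuous_fderiv one_ne_zero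
  have h6 := hf.continuous
  have h7 := continuous_accel hξ hvr har hvw hτ hrho hv hk
  unfold FpbarVel FpbarDeriv
  have e0 : Continuous fun q => (rho q, v q - D.vr (τ q)) := by fun_prop
  have e1 : Continuous fun q => fderiv ℝ (D.veh.equivDrag D.CD0) (v q - D.vw (τ q))
      (D.accel (τ q) (rho q) (v q) (k q) - deriv D.vw (τ q)) :=
    (h4.comp (hv.sub (h3.comp hτ))).clm_apply (h7.sub (h3'.comp hτ))
  have e2 : Continuous fun q => fderiv ℝ D.ξ (rho q, v q - D.vr (τ q))
      (D.f (rho q, v q - D.vr (τ q)), D.accel (τ q) (rho q) (v q) (k q) - D.ar (τ q)) :=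
    (h5.comp e0).clm_apply ((h6.comp e0).prodMk (h7.sub (h1.comp hτ)))
  fun_prop

theorem continuous_angVel (hf : ContDiff ℝ 1 D.f) (hξ : ContDiff ℝ 1 D.ξ)
    (hvr : Differentiable ℝ D.vr) (har : Differentiable ℝ (deriv D.vr))
    (har' : Differentiable ℝ (deriv (deriv D.vr))) (hvw : ContDiff ℝ 1 D.vw) (hc₂ : 0 < D.c₂)
    {η : ℝ} (hη : 0 < η) {g₁ g₂ : Rho p × E3 × E3 × ℝ → ℝ} (hg₁ : Continuous g₁)
    (hg₂ : Continuous g₂) (hτ : Continuous τ) (hrho : Continuous rho) (hv : Continuous v)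
    (hk : Continuous k) :
    Continuous fun q => D.angVel η g₁ g₂ (τ q) (rho q) (v q) (k q) := by
  have h1 := continuous_FpbarAt hξ hvr har hvw hτ hrho hv
  have h2 := continuous_FpbarVel hf hξ hvr har har' hvw hτ hrho hv hk
  have h3 : ∀ q, max ‖D.FpbarAt (τ q) (rho q) (v q)‖ η ≠ 0 := fun q =>
    (lt_max_of_lt_right hη).ne'
  have h4 : Continuous fun q => max ‖D.FpbarAt (τ q) (rho q) (v q)‖ η := by fun_prop
  unfold angVel
  have h5 : ∀ q, D.c₂ + ‖D.FpbarAt (τ q) (rho q) (v q)‖ ^ 2 ≠ 0 := fun q => by positivity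
  have e1 : Continuous fun q => cross (k q) ((max ‖D.FpbarAt (τ q) (rho q) (v q)‖ η)⁻¹ •
      D.FpbarAt (τ q) (rho q) (v q)) := hk.cross ((h4.inv₀ h3).smul h1)
  have e2 : Continuous fun q => cross (D.FpbarAt (τ q) (rho q) (v q))
      (D.FpbarVel (τ q) (rho q) (v q) (k q)) := h1.cross h2
  have e3 : Continuous fun q => ((max ‖D.FpbarAt (τ q) (rho q) (v q)‖ η) ^ 2)⁻¹ :=
    (h4.pow 2).inv₀ fun q => pow_ne_zero 2 (h3 q)
  have e4 : Continuous fun q => (inner ℝ (D.FpbarAt (τ q) (rho q) (v q))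
      (D.FpbarVel (τ q) (rho q) (v q) (k q)) : ℝ) / (D.c₂ + ‖D.FpbarAt (τ q) (rho q) (v q)‖ ^ 2) :=
    (h1.inner h2).div (by fun_prop) h5
  fun_prop

theorem continuous_loopField (hf : ContDiff ℝ 1 D.f) (hξ : ContDiff ℝ 1 D.ξ)
    (hvr : Differentiable ℝ D.vr) (har : Differentiable ℝ (deriv D.vr))
    (har' : Differentiable ℝ (deriv (deriv D.vr))) (hvw : ContDiff ℝ 1 D.vw) (hc₂ : 0 < D.c₂)
    {η : ℝ} (hη : 0 < η) {g₁ g₂ : Rho p × E3 × E3 × ℝ → ℝ} (hg₁ : Continuous g₁)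
    (hg₂ : Continuous g₂) :
    Continuous fun q : ℝ × ((Rho p × E3) × E3 × E3 × E3) => D.loopField η g₁ g₂ q.1 q.2 := by
  have h0 := hf.continuous
  have h1 : Continuous D.ar := har.continuous
  have h2 := hvr.continuous
  have hv : Continuous fun q : ℝ × ((Rho p × E3) × E3 × E3 × E3) => q.2.1.2 + D.vr q.1 := by
    fun_prop
  have ha := continuous_accel hξ hvr har hvw (τ := fun q : ℝ × ((Rho p × E3) × E3 × E3 × E3) =>
    q.1) (rho := fun q => q.2.1.1) (k := fun q => q.2.2.2.2) (by fun_prop) (by fun_prop) hv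
    (by fun_prop)
  have hω := continuous_angVel hf hξ hvr har har' hvw hc₂ hη hg₁ hg₂
    (τ := fun q : ℝ × ((Rho p × E3) × E3 × E3 × E3) => q.1)
    (rho := fun q => q.2.1.1) (k := fun q => q.2.2.2.2) (by fun_prop) (by fun_prop) hv
    (by fun_prop)
  exact ((h0.comp (by fun_prop)).prodMk (ha.sub (by fun_prop))).prodMk
    ((hω.cross (by fun_prop)).prodMk ((hω.cross (by fun_prop)).prodMk (hω.cross (by fun_prop))))

end Continuity

/-- The feedback law refers to derivatives along the trajectory, but `F̄_p` does not depend on the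
attitude, so its derivative involves the acceleration and not `ω`. The law is therefore explicit in
the state. -/
theorem angVel_eq_omega {I : Set ℝ} {x : ℝ → VehicleState p} {t : ℝ} (hc₂ : 0 < D.c₂)
    (hI : UniqueDiffWithinAt ℝ I t) {η : ℝ} (hη : 0 < η)
    (hP : η ≤ ‖D.FpbarAt t (x t).rho (x t).v‖)
    (h : HasDerivWithinAt (fun s => D.FpbarAt s (x s).rho (x s).v)
      (D.FpbarVel t (x t).rho (x t).v (x t).k) I t) {g₁ g₂ : Rho p × E3 × E3 × ℝ → ℝ}
    (hg₁ : g₁ ((x t).rho, (x t).v, (x t).k, t) = D.k₁ ((x t).rho, (x t).v, (x t).k, t))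
    (hg₂ : g₂ ((x t).rho, (x t).v, (x t).k, t) = D.lam ((x t).rho, (x t).v, (x t).k, t)) :
    D.angVel η g₁ g₂ t (x t).rho (x t).v (x t).k = D.omega I x t := by
  rw [omega_eq hc₂ hI (norm_pos_iff.1 (hη.trans_le hP)) h, angVel, max_eq_left hP, hg₁, hg₂, γ,
    Real.sq_sqrt (by positivity), kr]

/-- A solution of the extended vector field that remains in a regular tube, where the extension
agrees with the feedback law, is a solution of the closed loop. -/
theorem IsRegularTube.isClosedLoopSolution (hCD0 : D.veh.SphericalEquivalence D.CD0)
    (hξ : ContDiff ℝ 1 D.ξ) (hvr : Differentiable ℝ D.vr)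
    (har : Differentiable ℝ (deriv D.vr)) (hvw : ContDiff ℝ 1 D.vw) (hc₂ : 0 < D.c₂) {R L δ : ℝ}
    (htube : D.IsRegularTube R L δ) {g₁ g₂ : Rho p × E3 × E3 × ℝ → ℝ}
    (hg₁ : EqOn g₁ D.k₁ {q | ‖q.2.2.1‖ = 1 ∧ 0 ≤ q.2.2.2 ∧ δ / 2 ≤ ‖D.FpbarAt q.2.2.2 q.1 q.2.1‖})
    (hg₂ : EqOn g₂ D.lam {q | ‖q.2.2.1‖ = 1 ∧ 0 ≤ q.2.2.2 ∧ δ / 2 ≤ ‖D.FpbarAt q.2.2.2 q.1 q.2.1‖})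
    {I : Set ℝ} (hI : I ⊆ Ici 0) (hU : UniqueDiffOn ℝ I) {x : ℝ → VehicleState p}
    (hR : ∀ t ∈ I, ‖((x t).rho, (x t).v - D.vr t)‖ < R)
    (hx : ∀ t ∈ I, HasDerivWithinAt
      (fun s => (((x s).rho, (x s).v - D.vr s), (x s).i, (x s).j, (x s).k))
      (D.loopField (δ / 2) g₁ g₂ t (((x t).rho, (x t).v - D.vr t), (x t).i, (x t).j, (x t).k))
      I t) :
    D.IsClosedLoopSolution I x := by
  have hδ := htube.δ_pos
  have hP : ∀ t ∈ I, δ / 2 ≤ ‖D.FpbarAt t (x t).rho (x t).v‖ := fun t ht =>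
    htube.le_norm t (hI ht) _ _ (hR t ht)
  simp only [loopField, sub_add_cancel] at hx
  have hrho : ∀ t ∈ I, HasDerivWithinAt (fun s => (x s).rho)
      (D.f ((x t).rho, (x t).v - D.vr t)) I t := fun t ht => (hx t ht).fst.fst
  have hv : ∀ t ∈ I, HasDerivWithinAt (fun s => (x s).v)
      (D.accel t (x t).rho (x t).v (x t).k) I t := fun t ht => by
    have h1 : HasDerivWithinAt (fun s => (x s).v - D.vr s + D.vr s)
        (D.accel t (x t).rho (x t).v (x t).k - D.ar t + deriv D.vr t) I t :=
      (hx t ht).fst.snd.add (hvr t).hasDerivAt.hasDerivWithinAt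
    simpa only [ar, sub_add_cancel] using h1
  have hω : ∀ t ∈ I, D.angVel (δ / 2) g₁ g₂ t (x t).rho (x t).v (x t).k = D.omega I x t := by
    intro t ht
    have hmem := And.intro (x t).norm_k (And.intro (hI ht) (hP t ht))
    exact angVel_eq_omega hc₂ (hU t ht) (half_pos hδ) (hP t ht)
      (hasDerivWithinAt_FpbarAt hξ hvr har hvw (hrho t ht) (hv t ht))
      (hg₁ (x := ((x t).rho, (x t).v, (x t).k, t)) hmem)
      (hg₂ (x := ((x t).rho, (x t).v, (x t).k, t)) hmem)
  refine ⟨fun t ht => norm_pos_iff.1 ((half_pos hδ).trans_le (hP t ht)), hrho,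
    fun t ht => ?_, fun t ht => ?_, fun t ht => ?_, fun t ht => ?_⟩
  · rw [velocity_field_eq D hCD0]
    exact hv t ht
  · rw [← hω t ht]
    exact (hx t ht).snd.fst
  · rw [← hω t ht]
    exact (hx t ht).snd.snd.fst
  · rw [← hω t ht]
    exact (hx t ht).snd.snd.snd

theorem continuous_clip_state {R : ℝ} (hR : 0 < R) :
    Continuous fun z : (Rho p × E3) × E3 × E3 × E3 =>
      (clip R z.1, clip 2 z.2.1, clip 2 z.2.2.1, clip 2 z.2.2.2) := by
  have h1 : Continuous (clip R : Rho p × E3 → Rho p × E3) := continuous_clip hR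
  have h2 : Continuous (clip 2 : E3 → E3) := continuous_clip two_pos
  fun_prop

theorem norm_clip_state_le {R : ℝ} (hR : 0 < R) (z : (Rho p × E3) × E3 × E3 × E3) :
    ‖(clip R z.1, clip 2 z.2.1, clip 2 z.2.2.1, clip 2 z.2.2.2)‖ ≤ max R 2 := by
  have h2 : ∀ u : E3, ‖clip 2 u‖ ≤ max R 2 := fun u =>
    (norm_clip_le two_pos u).trans (le_max_right _ _)
  exact max_le ((norm_clip_le hR _).trans (le_max_left _ _))
    (max_le (h2 _) (max_le (h2 _) (h2 _)))

/-- The extended vector field, cut off at distance `R` from the reference, has a solution for all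
times. -/
theorem exists_solution_loopField_clip {η R : ℝ} {g₁ g₂ : Rho p × E3 × E3 × ℝ → ℝ}
    (hloop : Continuous fun q : ℝ × ((Rho p × E3) × E3 × E3 × E3) => D.loopField η g₁ g₂ q.1 q.2)
    (hR : 0 < R) (t₀ : ℝ) (x₀ : VehicleState p) :
    ∃ x : ℝ → VehicleState p, x t₀ = x₀ ∧ ∀ t ∈ Ici t₀, HasDerivWithinAt
      (fun s => (((x s).rho, (x s).v - D.vr s), (x s).i, (x s).j, (x s).k))
      (D.loopField η g₁ g₂ t
        (clip R ((x t).rho, (x t).v - D.vr t), (x t).i, (x t).j, (x t).k)) (Ici t₀) t := by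
  obtain ⟨z, hz0, hz⟩ := exists_hasDerivWithinAt_Ici_of_comp hloop (continuous_clip_state hR)
    (norm_clip_state_le hR) t₀ ((x₀.rho, x₀.v - D.vr t₀), x₀.i, x₀.j, x₀.k)
  have hframe := orthonormal_of_rotation (i := fun t => (z t).2.1) (j := fun t => (z t).2.2.1)
    (k := fun t => (z t).2.2.2) one_le_two
    (fun t ht => (hz t ht).snd.fst) (fun t ht => (hz t ht).snd.snd.fst)
    (fun t ht => (hz t ht).snd.snd.snd) (by simp only [hz0]; exact x₀.orthonormal)
    (by simp only [hz0]; exact x₀.direct)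
  have hstate : ∀ t, ∃ s : VehicleState p, t ∈ Ici t₀ →
      ((s.rho, s.v - D.vr t), s.i, s.j, s.k) = z t := by
    intro t
    by_cases ht : t ∈ Ici t₀
    · refine ⟨⟨(z t).1.1, (z t).1.2 + D.vr t, (z t).2.1, (z t).2.2.1, (z t).2.2.2,
        (hframe t ht).1, (hframe t ht).2⟩, fun _ => ?_⟩
      simp only [add_sub_cancel_right]
    · exact ⟨x₀, fun h => absurd h ht⟩
  choose s hs using hstate
  -- The chosen state matches `z` only componentwise; the update at `t₀` makes the initial state
  -- literally `x₀`.
  have hzx : ∀ t ∈ Ici t₀, (((Function.update s t₀ x₀ t).rho, (Function.update s t₀ x₀ t).v - D.vr t),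
      (Function.update s t₀ x₀ t).i, (Function.update s t₀ x₀ t).j,
      (Function.update s t₀ x₀ t).k) = z t := by
    intro t ht
    by_cases h : t = t₀
    · rw [h, Function.update_self, hz0]
    · rw [Function.update_of_ne h, hs t ht]
  refine ⟨Function.update s t₀ x₀, Function.update_self _ _ _, fun t ht => ?_⟩
  generalize Function.update s t₀ x₀ = x at hzx ⊢
  have hcut_eq : (clip R (z t).1, clip 2 (z t).2.1, clip 2 (z t).2.2.1, clip 2 (z t).2.2.2)
      = (clip R ((x t).rho, (x t).v - D.vr t), (x t).i, (x t).j, (x t).k) := by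
    rw [← hzx t ht]
    rw [clip_of_norm_le two_pos (by simp [(x t).norm_i]),
      clip_of_norm_le two_pos (by simp [(x t).norm_j]),
      clip_of_norm_le two_pos (by simp [(x t).norm_k])]
  have := (hz t ht).congr hzx (hzx t ht)
  rwa [hcut_eq] at this

/-- From each state close enough to the reference starts a solution for all times, provided that
the solutions obey an a priori bound. -/
theorem exists_isClosedLoopSolution (hCD0 : D.veh.SphericalEquivalence D.CD0)
    (hf : ContDiff ℝ 1 D.f) (hξ : ContDiff ℝ 1 D.ξ) (hvr : Differentiable ℝ D.vr)
    (har : Differentiable ℝ (deriv D.vr)) (har' : Differentiable ℝ (deriv (deriv D.vr)))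
    (hvw : ContDiff ℝ 1 D.vw) (hk₁ : ContinuousOn D.k₁ D.gainDomain)
    (hlam : ContinuousOn D.lam D.gainDomain) (hc₂ : 0 < D.c₂) {R L δ : ℝ}
    (htube : D.IsRegularTube R L δ) {t₀ : ℝ} (ht₀ : 0 ≤ t₀) (x₀ : VehicleState p)
    (hx₀ : ‖(x₀.rho, x₀.v - D.vr t₀)‖ < R)
    (hbound : ∀ (b : ℝ) (x : ℝ → VehicleState p), D.IsClosedLoopSolution (Ico t₀ b) x →
      x t₀ = x₀ → ∀ t ∈ Ico t₀ b, ‖((x t).rho, (x t).v - D.vr t)‖ ≤ R / 2) :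
    ∃ x : ℝ → VehicleState p, D.IsClosedLoopSolution (Ici t₀) x ∧ x t₀ = x₀ := by
  have hR := htube.R_pos
  have hδ := htube.δ_pos
  -- Extension needs a closed set, which `D.gainDomain` need not be; `S` is closed and contains
  -- every state of the tube at nonnegative times.
  set S : Set (Rho p × E3 × E3 × ℝ) :=
    {q | ‖q.2.2.1‖ = 1 ∧ 0 ≤ q.2.2.2 ∧ δ / 2 ≤ ‖D.FpbarAt q.2.2.2 q.1 q.2.1‖} with hS
  have hSsub : S ⊆ D.gainDomain := fun q hq =>
    ⟨hq.1, hq.2.1, norm_pos_iff.1 (by linarith [hq.2.2])⟩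
  have hScl : IsClosed S := by
    have h1 : Continuous fun q : Rho p × E3 × E3 × ℝ => D.FpbarAt q.2.2.2 q.1 q.2.1 :=
      continuous_FpbarAt hξ hvr har hvw (by fun_prop) (by fun_prop) (by fun_prop)
    have h2 : IsClosed {q : Rho p × E3 × E3 × ℝ | ‖q.2.2.1‖ = 1} :=
      isClosed_eq (by fun_prop) continuous_const
    have h3 : IsClosed {q : Rho p × E3 × E3 × ℝ | 0 ≤ q.2.2.2} :=
      isClosed_le continuous_const (by fun_prop)
    exact h2.inter (h3.inter (isClosed_le continuous_const h1.norm))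
  obtain ⟨g₁, hg₁, hg₁S⟩ := (hk₁.mono hSsub).exists_continuous_eqOn hScl
  obtain ⟨g₂, hg₂, hg₂S⟩ := (hlam.mono hSsub).exists_continuous_eqOn hScl
  obtain ⟨x, hx0, hx⟩ := exists_solution_loopField_clip
    (continuous_loopField hf hξ hvr har har' hvw hc₂ (half_pos hδ) hg₁ hg₂) hR t₀ x₀
  have hsol : ∀ I ⊆ Ici t₀, UniqueDiffOn ℝ I → (∀ t ∈ I, ‖((x t).rho, (x t).v - D.vr t)‖ < R) →
      D.IsClosedLoopSolution I x := fun I hI hU hxR =>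
    htube.isClosedLoopSolution hCD0 hξ hvr har hvw hc₂ hg₁S hg₂S
      (fun t ht => ht₀.trans (hI ht)) hU hxR fun t ht => by
        have := (hx t (hI ht)).mono hI
        rwa [clip_of_norm_le hR (hxR t ht).le] at this
  refine ⟨x, hsol _ Subset.rfl (uniqueDiffOn_Ici t₀) fun T hT => ?_, hx0⟩
  have hxc : ContinuousOn (fun t => ‖((x t).rho, (x t).v - D.vr t)‖) (Icc t₀ T) := fun t ht =>
    ((hx t ht.1).fst.continuousWithinAt.mono Icc_subset_Ici_self).norm
  -- Up to a time before which the trajectory stays in the tube it solves the closed loop. The a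
  -- priori bound then gives `R / 2` up to that time, and by continuity at that time.
  refine lt_of_continuation hxc (fun t ht hs => ?_) T ⟨hT, le_rfl⟩
  rcases ht.1.eq_or_lt with rfl | hlt
  · rw [hx0]; exact hx₀
  have hle := hbound t x (hsol _ Ico_subset_Ici_self (uniqueDiffOn_Ico _ _) hs) hx0
  have : ‖((x t).rho, (x t).v - D.vr t)‖ ≤ R / 2 := by
    refine ContinuousWithinAt.closure_le (s := Ico t₀ t)
      (f := fun t => ‖((x t).rho, (x t).v - D.vr t)‖)
      (g := fun _ => R / 2) ?_ ?_ continuousWithinAt_const hle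
    · rw [closure_Ico hlt.ne]; exact ⟨hlt.le, le_rfl⟩
    · exact (hxc t ht).mono fun s hs => ⟨hs.1, hs.2.le.trans ht.2⟩
  linarith

end TrackingData

/-! ### Proof of the proposition -/

theorem proposition4 {p : ℕ} (D : TrackingData p)
    -- the aerodynamic characteristics satisfy `C_D + C_L cot α = C_{D0}`
    (hCD0 : D.veh.SphericalEquivalence D.CD0)
    -- regularity of `f`, `ξ`, of the reference velocity and of the wind
    (hf : ContDiff ℝ 1 D.f) (hξ : ContDiff ℝ 1 D.ξ)
    (hvr : Differentiable ℝ D.vr ∧ Differentiable ℝ (deriv D.vr) ∧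
      Differentiable ℝ (deriv (deriv D.vr)))
    (hvw : ContDiff ℝ 1 D.vw)
    -- the reference air velocity is bounded
    (hvra : ∃ B : ℝ, ∀ t : ℝ, 0 ≤ t → ‖D.vr t - D.vw t‖ ≤ B)
    -- the gains
    (hk₁ : ContinuousOn D.k₁ D.gainDomain)
    (hk₁_pos : ∃ κ > 0, ∀ q ∈ D.gainDomain, κ ≤ D.k₁ q)
    (hlam : ContinuousOn D.lam D.gainDomain)
    (hc₂ : 0 < D.c₂)
    -- `ξ` locally exponentially stabilizes the fully actuated system
    (A1 : UniformlyLocallyExpStable D.IsFullyActuatedSolution (fun _ x => ‖x.1‖ + ‖x.2‖))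
    -- `F̄_p` is bounded away from zero along the reference
    (A2 : ∃ δ > 0, ∀ t : ℝ, 0 ≤ t → δ ≤ ‖D.FpbarRef t‖) :
    LocallyExpStable D.IsClosedLoopSolution D.closedLoopError ∧
    ((∃ B : ℝ, ∀ t : ℝ, 0 ≤ t → ‖D.ar t‖ ≤ B) →
      UniformlyLocallyExpStable D.IsClosedLoopSolution D.closedLoopError) := by

  obtain ⟨hvr, har, har'⟩ := hvr
  obtain ⟨B, hB⟩ := hvra
  obtain ⟨κ, hκ0, hκ⟩ := hk₁_pos
  obtain ⟨δ, hδ, hA2⟩ := A2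
  obtain ⟨r₁, hr₁, C₁, hC₁, μ₁, hμ₁, hdecay⟩ := TrackingData.exists_hasExpDecay_actuatedField A1
  have hfield : ContDiff ℝ 1 D.actuatedField := hf.prodMk hξ
  obtain ⟨K, U, hU, hKU⟩ := hfield.contDiffAt.exists_lipschitzOnWith (x := 0)
  obtain ⟨R₀, hR₀, hR₀U⟩ := Metric.mem_nhds_iff.1 hU
  have hK := hKU.mono hR₀U
  obtain ⟨R, L, htube⟩ := TrackingData.exists_isRegularTube hR₀ hK
    (TrackingData.actuatedField_zero hr₁ hdecay) hB hδ hA2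
  obtain ⟨μ, hμ, hest⟩ := TrackingData.exists_closedLoop_estimate hCD0 hξ hvr har hvw hc₂ hκ0 hκ
    hr₁ hC₁ hμ₁ hdecay hR₀ hK htube
  have main : ∀ Γ : ℝ, ∃ r > 0, ∃ C > 0, ∀ t₀ : ℝ, 0 ≤ t₀ → ‖D.FpbarRef t₀‖ ≤ Γ →
      ExpEstimate D.IsClosedLoopSolution D.closedLoopError t₀ r C μ := by
    intro Γ
    obtain ⟨r, hr, C, hC, h⟩ := hest Γ
    have hR := htube.R_pos
    -- The bound `R / 2 / C` turns the exponential estimate into the a priori bound `R / 2` needed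
    -- for existence.
    refine ⟨min (min r R) (R / 2 / C), by positivity, C, hC, fun t₀ ht₀ hΓ x₀ hx₀ => ?_⟩
    rw [lt_min_iff, lt_min_iff, lt_div_iff₀ hC] at hx₀
    have hsol : ∀ (b : ℝ) (x : ℝ → VehicleState p), D.IsClosedLoopSolution (Ico t₀ b) x →
        x t₀ = x₀ → ∀ t ∈ Ico t₀ b, D.closedLoopError t (x t)
          ≤ C * Real.exp (-μ * (t - t₀)) * D.closedLoopError t₀ x₀ := by
      intro b x hx hx0 t ht
      have := h t₀ ht₀ hΓ b x hx (by rw [hx0]; exact hx₀.1.1) t ht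
      rwa [hx0] at this
    refine ⟨TrackingData.exists_isClosedLoopSolution hCD0 hf hξ hvr har har' hvw hk₁ hlam hc₂ htube
      ht₀ x₀ ((TrackingData.norm_le_closedLoopError t₀ x₀).trans_lt hx₀.1.2)
      fun b x hx hx0 t ht => ?_, hsol⟩
    have h1 := (TrackingData.norm_le_closedLoopError t (x t)).trans (hsol b x hx hx0 t ht)
    have h2 : Real.exp (-μ * (t - t₀)) ≤ 1 :=
      Real.exp_le_one_iff.2 (by linarith [mul_nonneg hμ.le (sub_nonneg.2 ht.1)])
    have h3 : C * Real.exp (-μ * (t - t₀)) * D.closedLoopError t₀ x₀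
        ≤ C * 1 * D.closedLoopError t₀ x₀ := by
      have := TrackingData.closedLoopError_nonneg (D := D) t₀ x₀
      gcongr
    linarith [hx₀.2]
  constructor
  · refine ⟨μ, hμ, fun t₀ ht₀ => ?_⟩
    -- With no bound on `a_r`, `Γ` is the value at `t₀` itself, so `r` and `C` depend on `t₀`.
    obtain ⟨r, hr, C, hC, h⟩ := main ‖D.FpbarRef t₀‖
    exact ⟨r, hr, C, hC, h t₀ ht₀ le_rfl⟩
  · rintro ⟨Ba, hBa⟩
    -- Bounds on `v_r - v_w` and `a_r` give one `Γ` for all initial times.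
    obtain ⟨r, hr, C, hC, h⟩ := main
      (|D.veh.ka * D.CD0| * (B * B) + D.veh.m * (‖D.veh.gvec‖ + Ba))
    refine ⟨μ, hμ, r, hr, C, hC, fun t₀ ht₀ => h t₀ ht₀ ?_⟩
    rw [TrackingData.FpbarRef, TrackingData.Fpbar, sub_zero]
    refine (norm_add_le _ _).trans (add_le_add ?_ ?_)
    · rw [AxisymmetricVehicle.equivDrag_eq, norm_smul, norm_smul, norm_neg, norm_norm,
        Real.norm_eq_abs]
      have h1 := hB t₀ ht₀
      have h2 := (norm_nonneg _).trans h1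
      gcongr
    · rw [norm_smul, Real.norm_of_nonneg D.veh.m_pos.le]
      exact mul_le_mul_of_nonneg_left
        ((norm_sub_le _ _).trans (add_le_add le_rfl (hBa t₀ ht₀))) D.veh.m_pos.le
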